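/- A \emph{category of paths} is a small category $\Lambda$ (identified with its set of morphisms, called paths; objects are identified with identity morphisms and form the set $\Lambda^0$ of vertices; $s,r$ denote source and range, and $\alpha\beta$ is defined when $s(\alpha)=r(\beta)$) such that $\alpha\beta=\alpha\gamma$ implies $\beta=\gamma$, $\beta\alpha=\gamma\alpha$ implies $\beta=\gamma$, and $\alpha\beta=s(\beta)$ implies $\alpha=\beta=s(\beta)$. Write $v\Lambda$ for the paths with range $v$ and $\alpha\Lambda=\{\alpha\beta\}$ for the extensions of $\alpha$. For $F\subseteq\Lambda$, $\bigvee F$ is the set of minimal elements of $\bigcap_{\alpha\in F}\alpha\Lambda$ for the order ``$\beta$ extends $\alpha$''. $\Lambda$ is \emph{finitely aligned} if every $\alpha\Lambda\cap\beta\Lambda$ is a finite union of sets $\epsilon\Lambda$. A \emph{zigzag} is $\zeta=(\alpha_1,\beta_1,\dots,\alpha_n,\beta_n)$, $n\ge 1$, with $r(\alpha_i)=r(\beta_i)$ and $s(\alpha_{i+1})=s(\beta_i)$; $s(\zeta)=s(\beta_n)$, $r(\zeta)=s(\alpha_1)$, and its reverse is $\overline\zeta=(\beta_n,\alpha_n,\dots,\beta_1,\alpha_1)$.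 Let $\sigma^\alpha(\alpha\beta)=\beta$. The zigzag map $\varphi_\zeta=\sigma^{\alpha_1}\beta_1\cdots\sigma^{\alpha_n}\beta_n$ is a partial injection from $s(\zeta)\Lambda$ to $r(\zeta)\Lambda$, with domain denoted $A(\zeta)$. Let $\mathcal A_v$ be the ring of subsets of $v\Lambda$ generated by the sets $A(\zeta)$ with $s(\zeta)=v$, let $X_v$ be the space of ultrafilters (maximal filters) in $\mathcal A_v$ with the topology generated by the sets $\widehat E=\{x: E\in x\}$, $E\in\mathcal A_v$, and let $X=\bigsqcup_{v\in\Lambda^0}X_v$. Each $\zeta$ induces a homeomorphism $\Phi_\zeta:\widehat{A(\zeta)}\to\widehat{A(\overline\zeta)}$, where $\Phi_\zeta(x)$ is the ultrafilter generated by the sets $\varphi_\zeta(F)$, $F\in x$, $F\subseteq A(\zeta)$. The \emph{groupoid} $G$ of $\Lambda$ consists of the germs $[\zeta,x]$, $x\in\widehat{A(\zeta)}$, where $[\zeta,x]=[\zeta',x']$ iff $x=x'$ and $\Phi_\zeta=\Phi_{\zeta'}$ near $x$; the operations are $[\zeta,\Phi_{\zeta'}(x)][\zeta',x]=[\zeta\zeta',x]$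 and $[\zeta,x]^{-1}=[\overline\zeta,\Phi_\zeta(x)]$, and the sets $\{[\zeta,x]:x\in\widehat E\cap\widehat{A(\zeta)}\}$, $E\in\mathcal A_{s(\zeta)}$, form a base of its topology. A \emph{degree functor} on $\Lambda$ is a map $\psi$ from $\Lambda$ to an abelian group $Q$ with $\psi(\alpha\beta)=\psi(\alpha)+\psi(\beta)$ whenever $\alpha\beta$ is defined. It is \emph{nondegenerate} if $\psi(\alpha)\neq 0$ for $\alpha\notin\Lambda^0$, and \emph{non-isotropic} if, whenever $(\alpha_i)_{i\ge1}$ and $(\beta_i)_{i\ge1}$ are sequences in $\Lambda$ with $\alpha_i\alpha_{i+1}=\beta_i\beta_{i+1}$ for all $i$ (the products being defined) and $\psi(\alpha_1)=\psi(\beta_1)$, then $\alpha_1=\beta_1$. It defines a homomorphism $c_\psi:G\to Q$ by $c_\psi([\zeta,x])=\sum_{i=1}^n\bigl(\psi(\beta_i)-\psi(\alpha_i)\bigr)$. A groupoid with a topology is \emph{elementary} if it is isomorphic, as a topological groupoid, to a disjoint union of a sequence of products $Y_i\times(I_{n_i}\times I_{n_i})$, where $Y_i$ is a topological space (consisting of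 units) and $I_{n_i}\times I_{n_i}$ is the (discrete) transitive principal groupoid on a finite set with $n_i$ elements. It is an \emph{AF groupoid} if its unit space is Hausdorff, locally compact, second countable and totally disconnected, and it is the union of an increasing sequence of open elementary subgroupoids, each containing all units. \textbf{Theorem.} Let $\Lambda$ be a countable finitely aligned category of paths, and let $\psi:\Lambda\to Q$ be a nondegenerate, non-isotropic degree functor such that: (1) if $E\subseteq\Lambda$ is infinite and $\psi(\alpha)=\psi(\beta)$ for all $\alpha,\beta\in E$, then there is a finite subset $F\subseteq E$ with $\bigvee F=\emptyset$; (2) for every finite $S\subseteq\psi(\Lambda)$ there is a finite $T\subseteq\psi(\Lambda)$ with $S\subseteq T$ such that for every finite $E\subseteq\Lambda$, $\psi(E)\subseteq T$ implies $\psi(\bigvee E)\subseteq T$. Then $G^\psi=\{g\in G:c_\psi(g)=0\}$, with the relative topology, is an AF groupoid. -/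

import Mathlib

open CategoryTheory Topology

universe u w

namespace PathCat

/-! ### Categories of paths -/

/-- A category of paths: a small category that is left-cancellative and right-cancellative and has
no inverses.  The paper-style product `αβ` (defined when `s(α) = r(β)`) is the composite `β ≫ α`, so
that a morphism `α : a ⟶ b` has source `s(α) = a` and range `r(α) = b`. -/
class CategoryOfPaths (C : Type u) [SmallCategory C] : Prop where
  /-- `αβ = αγ` implies `β = γ`. -/
  left_cancel : ∀ {a b c : C} (α : b ⟶ c) (β γ : a ⟶ b), β ≫ α = γ ≫ α → β = γ
  /-- `βα = γα` implies `β = γ`. -/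
  right_cancel : ∀ {a b c : C} (α : a ⟶ b) (β γ : b ⟶ c), α ≫ β = α ≫ γ → β = γ
  /-- `αβ = s(β)` implies `α = β = s(β)`. -/
  no_inverses : ∀ {a b : C} (α : b ⟶ a) (β : a ⟶ b), β ≫ α = 𝟙 a →
    ∃ h : b = a, α = eqToHom h ∧ β = eqToHom h.symm

/-- The set `Λ` of all paths (morphisms) of the category. -/
abbrev PathSet (C : Type u) [SmallCategory C] : Type u := Quiver.Total C

/-- The set `vΛ` of all paths with range `v`. -/
abbrev PathsTo {C : Type u} [SmallCategory C] (v : C) : Type u := Σ x : C, (x ⟶ v)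

section Extensions

variable {C : Type u} [SmallCategory C]

/-- `IsProd α β γ`: the product `αβ` is defined and equals `γ`. -/
def IsProd (α β γ : PathSet C) : Prop :=
  ∃ (a b c : C) (f : b ⟶ c) (g : a ⟶ b), α = ⟨b, c, f⟩ ∧ β = ⟨a, b, g⟩ ∧ γ = ⟨a, c, g ≫ f⟩

/-- The tail set `αΛ` of all extensions of `α`. -/
def tails (α : PathSet C) : Set (PathSet C) := {γ | ∃ β, IsProd α β γ}

/-- `⋁ F`: the set of minimal common extensions of the elements of `F`, i.e. the minimal elements of
`⋂ α ∈ F, αΛ` for the order "`α` is an initial segment of `β`". -/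
def minCommonExt (F : Set (PathSet C)) : Set (PathSet C) :=
  {γ | γ ∈ ⋂ α ∈ F, tails α ∧ ∀ δ ∈ ⋂ α ∈ F, tails α, γ ∈ tails δ → δ = γ}

end Extensions

/-- `Λ` is finitely aligned: every `αΛ ∩ βΛ` is a finite union of tail sets. -/
def FinitelyAligned (C : Type u) [SmallCategory C] : Prop :=
  ∀ α β : PathSet C, ∃ G : Set (PathSet C), G.Finite ∧ tails α ∩ tails β = ⋃ ε ∈ G, tails ε

/-! ### Degree functors -/

/-- A (generalized) degree functor: a homomorphism from `Λ` to an abelian group `Q`. -/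
structure DegreeFunctor (C : Type u) [SmallCategory C] (Q : Type w) [AddCommGroup Q] where
  /-- the degree of a path -/
  deg : ∀ {a b : C}, (a ⟶ b) → Q
  deg_mul : ∀ {a b c : C} (α : b ⟶ c) (β : a ⟶ b), deg (β ≫ α) = deg α + deg β

namespace DegreeFunctor

variable {C : Type u} [SmallCategory C] {Q : Type w} [AddCommGroup Q] (ψ : DegreeFunctor C Q)

/-- The degree functor as a map on the set of all paths. -/
def toFun (α : PathSet C) : Q := ψ.deg α.hom

/-- `ψ(α) ≠ 0` for every path `α` that is not a vertex. -/
def Nondegenerate : Prop := ∀ α : PathSet C, (∀ v : C, α ≠ ⟨v, v, 𝟙 v⟩) → ψ.toFun α ≠ 0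

/-- If `α_i α_{i+1} = β_i β_{i+1}` for all `i` and `ψ(α_0) = ψ(β_0)` then `α_0 = β_0`. -/
def NonIsotropic : Prop :=
  ∀ α β : ℕ → PathSet C,
    (∀ i, ∃ γ, IsProd (α i) (α (i + 1)) γ ∧ IsProd (β i) (β (i + 1)) γ) →
    ψ.toFun (α 0) = ψ.toFun (β 0) → α 0 = β 0

/-- No infinite set of paths of equal degree is such that all of its finite subsets have (minimal)
common extensions. -/
def EqualDegreeFiniteness : Prop :=
  ∀ E : Set (PathSet C), E.Infinite → (∀ α ∈ E, ∀ β ∈ E, ψ.toFun α = ψ.toFun β) →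
    ∃ F ⊆ E, F.Finite ∧ minCommonExt F = ∅

/-- Every finite set of degrees is contained in a finite set of degrees that is closed under
minimal common extensions. -/
def ExtensionFiniteness : Prop :=
  ∀ S : Set Q, S.Finite → S ⊆ Set.range ψ.toFun →
    ∃ T : Set Q, T.Finite ∧ T ⊆ Set.range ψ.toFun ∧ S ⊆ T ∧
      ∀ E : Set (PathSet C), E.Finite → ψ.toFun '' E ⊆ T → ψ.toFun '' minCommonExt E ⊆ T

end DegreeFunctor

/-! ### Zigzags -/

/-- `Zigzag a b` is the type of zigzags `ζ = (α₁, β₁, …, αₙ, βₙ)`, `n ≥ 1`, with `r(αᵢ) = r(βᵢ)`,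
`s(αᵢ₊₁) = s(βᵢ)`, range `r(ζ) = s(α₁) = a` and source `s(ζ) = s(βₙ) = b`. -/
inductive Zigzag {C : Type u} [SmallCategory C] : C → C → Type u
  | single {a b c : C} (α : a ⟶ c) (β : b ⟶ c) : Zigzag a b
  | cons {a b c d : C} (α : a ⟶ c) (β : b ⟶ c) (ζ : Zigzag b d) : Zigzag a d

namespace Zigzag

variable {C : Type u} [SmallCategory C]

/-- Concatenation of zigzags. -/
def append : ∀ {a b c : C}, Zigzag a b → Zigzag b c → Zigzag a c
  | _, _, _, single α β, ξ => cons α β ξ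
  | _, _, _, cons α β ζ, ξ => cons α β (append ζ ξ)

/-- The reverse `(βₙ, αₙ, …, β₁, α₁)`. -/
def reverse : ∀ {a b : C}, Zigzag a b → Zigzag b a
  | _, _, single α β => single β α
  | _, _, cons α β ζ => append (reverse ζ) (single β α)

/-- The graph of the zigzag map `φ_ζ = σ^{α₁} β₁ ⋯ σ^{αₙ} βₙ`: `ζ.Rel m n` says that `φ_ζ(m)` is
defined and equals `n`.  (The map `σ^α β` sends `m` to the `n` with `βm = αn`; zigzag maps do not
change the source of a path.) -/
def Rel : ∀ {a b : C}, Zigzag a b → ∀ {x : C}, (x ⟶ b) → (x ⟶ a) → Prop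
  | _, _, single α β, _, m, n => m ≫ β = n ≫ α
  | _, _, cons α β ζ, _, m, n => ∃ k, Rel ζ m k ∧ k ≫ β = n ≫ α

/-- `φ_ζ⁻¹(E)`. -/
def preimage {a b : C} (ζ : Zigzag a b) (E : Set (PathsTo a)) : Set (PathsTo b) :=
  {μ | ∃ n : μ.1 ⟶ a, ζ.Rel μ.2 n ∧ (⟨μ.1, n⟩ : PathsTo a) ∈ E}

/-- The zigzag set `A(ζ)`, the domain of `φ_ζ`. -/
def dom {a b : C} (ζ : Zigzag a b) : Set (PathsTo b) := {μ | ∃ n : μ.1 ⟶ a, ζ.Rel μ.2 n}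

/-- `∑ᵢ ψ(βᵢ) - ψ(αᵢ)`. -/
def degree {Q : Type w} [AddCommGroup Q] (ψ : DegreeFunctor C Q) : ∀ {a b : C}, Zigzag a b → Q
  | _, _, single α β => ψ.deg β - ψ.deg α
  | _, _, cons α β ζ => (ψ.deg β - ψ.deg α) + degree ψ ζ

theorem rel_append {a b c : C} (ζ : Zigzag a b) (ξ : Zigzag b c) {x : C} (m : x ⟶ c) (n : x ⟶ a) :
    (ζ.append ξ).Rel m n ↔ ∃ k, ξ.Rel m k ∧ ζ.Rel k n := by
  induction ζ with
  | single α β => rfl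
  | cons α β ζ ih =>
    simp only [append, Rel, ih]
    constructor
    · rintro ⟨k, ⟨l, h1, h2⟩, h3⟩
      exact ⟨l, h1, k, h2, h3⟩
    · rintro ⟨l, h1, k, h2, h3⟩
      exact ⟨k, ⟨l, h1, h2⟩, h3⟩

theorem rel_reverse {a b : C} (ζ : Zigzag a b) {x : C} (m : x ⟶ b) (n : x ⟶ a) :
    ζ.reverse.Rel n m ↔ ζ.Rel m n := by
  induction ζ with
  | single α β => exact eq_comm
  | cons α β ζ ih =>
    simp only [reverse, rel_append, Rel, ih]
    constructor
    · rintro ⟨k, h1, h2⟩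
      exact ⟨k, h2, h1.symm⟩
    · rintro ⟨k, h1, h2⟩
      exact ⟨k, h2.symm, h1⟩

theorem rel_unique [CategoryOfPaths C] {a b : C} (ζ : Zigzag a b) {x : C} {m : x ⟶ b}
    {n n' : x ⟶ a} (h : ζ.Rel m n) (h' : ζ.Rel m n') : n = n' := by
  induction ζ with
  | single α β => exact CategoryOfPaths.left_cancel α n n' (h.symm.trans h')
  | cons α β ζ ih =>
    obtain ⟨k, h1, h2⟩ := h
    obtain ⟨k', h1', h2'⟩ := h'
    obtain rfl := ih h1 h1'
    exact CategoryOfPaths.left_cancel α n n' (h2.symm.trans h2')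

theorem degree_append {Q : Type w} [AddCommGroup Q] (ψ : DegreeFunctor C Q) {a b c : C}
    (ζ : Zigzag a b) (ξ : Zigzag b c) :
    (ζ.append ξ).degree ψ = ζ.degree ψ + ξ.degree ψ := by
  induction ζ with
  | single α β => rfl
  | cons α β ζ ih => simp only [append, degree, ih, add_assoc]

theorem degree_reverse {Q : Type w} [AddCommGroup Q] (ψ : DegreeFunctor C Q) {a b : C}
    (ζ : Zigzag a b) : ζ.reverse.degree ψ = - ζ.degree ψ := by
  induction ζ with
  | single α β => simp [reverse, degree]
  | cons α β ζ ih =>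
    simp only [reverse, degree, degree_append, ih]
    abel

theorem degree_of_rel {Q : Type w} [AddCommGroup Q] (ψ : DegreeFunctor C Q) {a b : C}
    (ζ : Zigzag a b) {x : C} {m : x ⟶ b} {n : x ⟶ a} (h : ζ.Rel m n) :
    ζ.degree ψ = ψ.deg n - ψ.deg m := by
  induction ζ with
  | single α β =>
    have h1 := congrArg ψ.deg (show m ≫ β = n ≫ α from h)
    rw [ψ.deg_mul, ψ.deg_mul] at h1
    simp only [degree]
    rw [eq_sub_of_add_eq h1]
    abel
  | cons α β ζ ih =>
    obtain ⟨k, h1, h2⟩ := h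
    have h3 := congrArg ψ.deg h2
    rw [ψ.deg_mul, ψ.deg_mul] at h3
    simp only [degree]
    rw [ih h1, eq_sub_of_add_eq h3]
    abel

end Zigzag

/-! ### The rings `𝒜_v` and their ultrafilters -/

section Rings

variable {C : Type u} [SmallCategory C]

/-- `𝒜_v`: the ring of subsets of `vΛ` generated by the zigzag sets `A(ζ)`, `s(ζ) = v`. -/
def ring (v : C) : Set (Set (PathsTo v)) :=
  {E | ∀ R : Set (Set (PathsTo v)), MeasureTheory.IsSetRing R →
    (∀ (a : C) (ζ : Zigzag a v), ζ.dom ∈ R) → E ∈ R}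

theorem dom_mem_ring {a v : C} (ζ : Zigzag a v) : ζ.dom ∈ ring v := fun _ _ h => h a ζ

theorem isSetRing_ring (v : C) : MeasureTheory.IsSetRing (ring v) where
  empty_mem := fun _ hR _ => hR.empty_mem
  union_mem := fun _ _ hs ht R hR h => hR.union_mem (hs R hR h) (ht R hR h)
  sdiff_mem := fun _ _ hs ht R hR h => hR.sdiff_mem (hs R hR h) (ht R hR h)

theorem univ_mem_ring (v : C) : Set.univ ∈ ring v := by
  have h : (Zigzag.single (𝟙 v) (𝟙 v)).dom = Set.univ :=
    Set.eq_univ_of_forall fun μ => ⟨μ.2, rfl⟩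
  exact h ▸ dom_mem_ring (Zigzag.single (𝟙 v) (𝟙 v))

theorem compl_mem_ring {v : C} {E : Set (PathsTo v)} (hE : E ∈ ring v) : Eᶜ ∈ ring v := by
  rw [Set.compl_eq_univ_sdiff]
  exact (isSetRing_ring v).sdiff_mem (univ_mem_ring v) hE

theorem inter_mem_ring {v : C} {E F : Set (PathsTo v)} (hE : E ∈ ring v) (hF : F ∈ ring v) :
    E ∩ F ∈ ring v := (isSetRing_ring v).inter_mem hE hF

theorem preimage_mem_ring [CategoryOfPaths C] {a b : C} (ζ : Zigzag a b) {E : Set (PathsTo a)}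
    (hE : E ∈ ring a) : ζ.preimage E ∈ ring b := by
  refine hE {E | ζ.preimage E ∈ ring b} ⟨?_, ?_, ?_⟩ ?_
  · have h : ζ.preimage ∅ = ∅ := Set.eq_empty_of_forall_notMem fun μ ⟨_, _, h⟩ => h
    show ζ.preimage ∅ ∈ ring b
    exact h ▸ (isSetRing_ring b).empty_mem
  · intro s t hs ht
    have h : ζ.preimage (s ∪ t) = ζ.preimage s ∪ ζ.preimage t := by
      ext μ
      constructor
      · rintro ⟨n, h1, h2 | h2⟩
        · exact Or.inl ⟨n, h1, h2⟩
        · exact Or.inr ⟨n, h1, h2⟩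
      · rintro (⟨n, h1, h2⟩ | ⟨n, h1, h2⟩)
        · exact ⟨n, h1, Or.inl h2⟩
        · exact ⟨n, h1, Or.inr h2⟩
    show ζ.preimage (s ∪ t) ∈ ring b
    exact h ▸ (isSetRing_ring b).union_mem hs ht
  · intro s t hs ht
    have h : ζ.preimage (s \ t) = ζ.preimage s \ ζ.preimage t := by
      ext μ
      constructor
      · rintro ⟨n, h1, h2, h3⟩
        refine ⟨⟨n, h1, h2⟩, ?_⟩
        rintro ⟨n', h1', h4⟩
        obtain rfl := ζ.rel_unique h1 h1'
        exact h3 h4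
      · rintro ⟨⟨n, h1, h2⟩, h3⟩
        exact ⟨n, h1, h2, fun h4 => h3 ⟨n, h1, h4⟩⟩
    show ζ.preimage (s \ t) ∈ ring b
    exact h ▸ (isSetRing_ring b).sdiff_mem hs ht
  · intro c ξ
    have h : ζ.preimage ξ.dom = (ξ.append ζ).dom := by
      ext μ
      constructor
      · rintro ⟨n, h1, k, h2⟩
        exact ⟨k, (Zigzag.rel_append _ _ _ _).2 ⟨n, h1, h2⟩⟩
      · rintro ⟨k, h⟩
        obtain ⟨n, h1, h2⟩ := (Zigzag.rel_append _ _ _ _).1 h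
        exact ⟨n, h1, k, h2⟩
    show ζ.preimage ξ.dom ∈ ring b
    exact h ▸ dom_mem_ring _

end Rings

/-- A filter in a ring of sets: a nonempty collection of nonempty elements of the ring, closed under
intersections and under supersets in the ring. -/
structure IsFilterIn {X : Type u} (A U : Set (Set X)) : Prop where
  sub : U ⊆ A
  nonempty : U.Nonempty
  empty_notMem : ∅ ∉ U
  inter_mem : ∀ {E F : Set X}, E ∈ U → F ∈ U → E ∩ F ∈ U
  mem_of_superset : ∀ {E F : Set X}, E ∈ U → F ∈ A → E ⊆ F → F ∈ U

/-- An ultrafilter in a ring of sets: a maximal filter. -/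
structure IsUltrafilterIn {X : Type u} (A U : Set (Set X)) : Prop where
  isFilter : IsFilterIn A U
  maximal : ∀ V : Set (Set X), IsFilterIn A V → U ⊆ V → V = U

/-- `X_v`: the set of ultrafilters in `𝒜_v`. -/
@[ext]
structure Spec {C : Type u} [SmallCategory C] (v : C) where
  /-- the members of the ultrafilter -/
  sets : Set (Set (PathsTo v))
  isUltrafilter : IsUltrafilterIn (ring v) sets

namespace Spec

variable {C : Type u} [SmallCategory C] {v : C}

/-- `Ê = {x ∈ X_v : E ∈ 𝒰_x}`. -/
def hat (E : Set (PathsTo v)) : Set (Spec v) := {x | E ∈ x.sets}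

/-- The topology of `X_v`, generated by the sets `Ê`, `E ∈ 𝒜_v`. -/
instance : TopologicalSpace (Spec v) :=
  TopologicalSpace.generateFrom {W | ∃ E ∈ ring v, W = hat E}

theorem mem_ring (x : Spec v) {E : Set (PathsTo v)} (h : E ∈ x.sets) : E ∈ ring v :=
  x.isUltrafilter.isFilter.sub h

theorem inter_mem (x : Spec v) {E F : Set (PathsTo v)} (hE : E ∈ x.sets) (hF : F ∈ x.sets) :
    E ∩ F ∈ x.sets := x.isUltrafilter.isFilter.inter_mem hE hF

theorem superset_mem (x : Spec v) {E F : Set (PathsTo v)} (hE : E ∈ x.sets) (hF : F ∈ ring v)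
    (h : E ⊆ F) : F ∈ x.sets := x.isUltrafilter.isFilter.mem_of_superset hE hF h

theorem univ_mem (x : Spec v) : Set.univ ∈ x.sets := by
  obtain ⟨E, hE⟩ := x.isUltrafilter.isFilter.nonempty
  exact x.superset_mem hE (univ_mem_ring v) (Set.subset_univ E)

theorem nonempty_of_mem (x : Spec v) {E : Set (PathsTo v)} (h : E ∈ x.sets) : E.Nonempty := by
  rw [Set.nonempty_iff_ne_empty]
  rintro rfl
  exact x.isUltrafilter.isFilter.empty_notMem h

theorem mem_or_compl_mem (x : Spec v) {E : Set (PathsTo v)} (hE : E ∈ ring v) :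
    E ∈ x.sets ∨ Eᶜ ∈ x.sets := by
  by_cases h : ∃ F ∈ x.sets, F ∩ E = ∅
  · obtain ⟨F, hF, hFE⟩ := h
    refine Or.inr (x.superset_mem hF (compl_mem_ring hE) fun μ hμ hE' => ?_)
    exact (hFE ▸ (⟨hμ, hE'⟩ : μ ∈ F ∩ E) : μ ∈ (∅ : Set _))
  · push Not at h
    left
    have hV : IsFilterIn (ring v) {G | G ∈ ring v ∧ ∃ F ∈ x.sets, F ∩ E ⊆ G} := by
      refine ⟨fun G hG => hG.1, ⟨E, hE, Set.univ, x.univ_mem, Set.inter_subset_right⟩, ?_, ?_, ?_⟩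
      · rintro ⟨-, F, hF, hFE⟩
        exact (h F hF).ne_empty (Set.subset_empty_iff.1 hFE)
      · rintro G G' ⟨hG, F, hF, hFE⟩ ⟨hG', F', hF', hFE'⟩
        exact ⟨inter_mem_ring hG hG', F ∩ F', x.inter_mem hF hF',
          fun μ hμ => ⟨hFE ⟨hμ.1.1, hμ.2⟩, hFE' ⟨hμ.1.2, hμ.2⟩⟩⟩
      · rintro G G' ⟨hG, F, hF, hFE⟩ hG' hGG'
        exact ⟨hG', F, hF, hFE.trans hGG'⟩
    have hmax := x.isUltrafilter.maximal _ hV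
      fun F hF => ⟨x.mem_ring hF, F, hF, Set.inter_subset_left⟩
    rw [← hmax]
    exact ⟨hE, Set.univ, x.univ_mem, Set.inter_subset_right⟩

theorem isUltrafilterIn_of {U : Set (Set (PathsTo v))} (hU : IsFilterIn (ring v) U)
    (h : ∀ E ∈ ring v, E ∈ U ∨ Eᶜ ∈ U) : IsUltrafilterIn (ring v) U := by
  refine ⟨hU, fun V hV hUV => Set.Subset.antisymm (fun E hE => ?_) hUV⟩
  rcases h E (hV.sub hE) with h1 | h1
  · exact h1
  · exact (hV.empty_notMem (by simpa using hV.inter_mem hE (hUV h1))).elim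

theorem mem_nhds_iff (x : Spec v) (W : Set (Spec v)) :
    W ∈ 𝓝 x ↔ ∃ E ∈ x.sets, hat E ⊆ W := by
  have hb : TopologicalSpace.IsTopologicalBasis {W : Set (Spec v) | ∃ E ∈ ring v, W = hat E} := by
    refine ⟨?_, ?_, rfl⟩
    · rintro _ ⟨E, hE, rfl⟩ _ ⟨F, hF, rfl⟩ y ⟨hy1, hy2⟩
      refine ⟨hat (E ∩ F), ⟨E ∩ F, inter_mem_ring hE hF, rfl⟩, y.inter_mem hy1 hy2, fun z hz => ?_⟩
      exact ⟨z.superset_mem hz hE Set.inter_subset_left,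
        z.superset_mem hz hF Set.inter_subset_right⟩
    · exact Set.eq_univ_of_forall fun y =>
        ⟨hat Set.univ, ⟨Set.univ, univ_mem_ring v, rfl⟩, y.univ_mem⟩
  rw [hb.mem_nhds_iff]
  constructor
  · rintro ⟨_, ⟨E, hE, rfl⟩, h1, h2⟩
    exact ⟨E, h1, h2⟩
  · rintro ⟨E, hE, h⟩
    exact ⟨hat E, ⟨E, x.mem_ring hE, rfl⟩, hE, h⟩

/-- The fixed ultrafilter `𝒰_μ = {E ∈ 𝒜_v : μ ∈ E}`. -/
def fixed (μ : PathsTo v) : Spec v where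
  sets := {E | E ∈ ring v ∧ μ ∈ E}
  isUltrafilter := by
    refine isUltrafilterIn_of ⟨fun _ h => h.1, ⟨_, univ_mem_ring v, trivial⟩, fun h => h.2, ?_, ?_⟩
      fun E hE => ?_
    · exact fun h h' => ⟨inter_mem_ring h.1 h'.1, h.2, h'.2⟩
    · exact fun h h' h'' => ⟨h', h'' h.2⟩
    · by_cases h : μ ∈ E
      · exact Or.inl ⟨hE, h⟩
      · exact Or.inr ⟨compl_mem_ring hE, h⟩

/-- The homeomorphism `Φ_ζ` from `{x : A(ζ) ∈ 𝒰_x}` onto `{x : A(ζ̄) ∈ 𝒰_x}` induced by the zigzag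
map `φ_ζ`: the ultrafilter of `Φ_ζ(x)` is generated by the sets `φ_ζ(F)`, `F ∈ 𝒰_x`, `F ⊆ A(ζ)`;
that is, `E` belongs to it if and only if `φ_ζ⁻¹(E)` belongs to `𝒰_x`. -/
def map [CategoryOfPaths C] {a b : C} (ζ : Zigzag a b) (x : Spec b) (hx : ζ.dom ∈ x.sets) :
    Spec a where
  sets := {E | E ∈ ring a ∧ ζ.preimage E ∈ x.sets}
  isUltrafilter := by
    refine isUltrafilterIn_of ⟨fun _ h => h.1, ⟨Set.univ, univ_mem_ring a, ?_⟩, ?_, ?_, ?_⟩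
      fun E hE => ?_
    · exact x.superset_mem hx (preimage_mem_ring ζ (univ_mem_ring a))
        fun μ ⟨n, hn⟩ => ⟨n, hn, trivial⟩
    · rintro ⟨-, h⟩
      obtain ⟨_, _, _, h⟩ := x.nonempty_of_mem h
      exact h
    · rintro E F ⟨hE, hE'⟩ ⟨hF, hF'⟩
      refine ⟨inter_mem_ring hE hF, x.superset_mem (x.inter_mem hE' hF')
        (preimage_mem_ring ζ (inter_mem_ring hE hF)) ?_⟩
      rintro μ ⟨⟨n, h1, h2⟩, n', h1', h2'⟩
      obtain rfl := ζ.rel_unique h1 h1'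
      exact ⟨n, h1, h2, h2'⟩
    · rintro E F ⟨hE, hE'⟩ hF hEF
      exact ⟨hF, x.superset_mem hE' (preimage_mem_ring ζ hF)
        fun μ ⟨n, h1, h2⟩ => ⟨n, h1, hEF h2⟩⟩
    · rcases x.mem_or_compl_mem (preimage_mem_ring ζ hE) with h | h
      · exact Or.inl ⟨hE, h⟩
      · refine Or.inr ⟨compl_mem_ring hE, x.superset_mem (x.inter_mem hx h)
          (preimage_mem_ring ζ (compl_mem_ring hE)) ?_⟩
        rintro μ ⟨⟨n, h1⟩, h2⟩
        exact ⟨n, h1, fun h3 => h2 ⟨n, h1, h3⟩⟩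

variable [CategoryOfPaths C]

theorem map_fixed {a b x : C} (ζ : Zigzag a b) (m : x ⟶ b) (n : x ⟶ a) (h : ζ.Rel m n)
    (hx : ζ.dom ∈ (fixed (⟨x, m⟩ : PathsTo b)).sets) :
    map ζ (fixed ⟨x, m⟩) hx = fixed ⟨x, n⟩ := by
  ext E
  constructor
  · rintro ⟨hE, -, n', h1, h2⟩
    obtain rfl := ζ.rel_unique h h1
    exact ⟨hE, h2⟩
  · rintro ⟨hE, hn⟩
    exact ⟨hE, preimage_mem_ring ζ hE, n, h, hn⟩

theorem fixed_injective {x : C} {m n : x ⟶ v}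
    (h : fixed (⟨x, m⟩ : PathsTo v) = fixed (⟨x, n⟩ : PathsTo v)) : m = n := by
  -- both paths extend each other
  have key : ∀ {m n : x ⟶ v}, fixed (⟨x, m⟩ : PathsTo v) = fixed (⟨x, n⟩ : PathsTo v) →
      ∃ k : x ⟶ x, n = k ≫ m := by
    intro m n h
    have h1 : (Zigzag.single m (𝟙 v)).dom ∈ (fixed (⟨x, m⟩ : PathsTo v)).sets :=
      ⟨dom_mem_ring _, 𝟙 x, by simp [Zigzag.Rel]⟩
    rw [h] at h1
    obtain ⟨-, k, hk⟩ := h1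
    exact ⟨k, by simpa [Zigzag.Rel] using hk⟩
  obtain ⟨k, hk⟩ := key h
  obtain ⟨l, hl⟩ := key h.symm
  have h1 : k ≫ l = 𝟙 x := by
    refine CategoryOfPaths.left_cancel n _ _ ?_
    rw [Category.assoc, ← hl, ← hk, Category.id_comp]
  obtain ⟨_, -, h3⟩ := CategoryOfPaths.no_inverses l k h1
  rw [hk, h3]
  simp

/-- If two zigzag maps agree on a member of the ultrafilter, their induced maps agree there. -/
theorem map_eq_of_rel_iff {a b : C} (ζ ξ : Zigzag a b) (x : Spec b) (hζ : ζ.dom ∈ x.sets)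
    (hξ : ξ.dom ∈ x.sets) (E : Set (PathsTo b)) (hE : E ∈ x.sets)
    (h : ∀ μ ∈ E, ∀ n, ζ.Rel μ.2 n ↔ ξ.Rel μ.2 n) : map ζ x hζ = map ξ x hξ := by
  ext F
  constructor
  · rintro ⟨hF, hF'⟩
    exact ⟨hF, x.superset_mem (x.inter_mem hE hF') (preimage_mem_ring ξ hF)
      fun μ ⟨h1, n, h2, h3⟩ => ⟨n, (h μ h1 n).1 h2, h3⟩⟩
  · rintro ⟨hF, hF'⟩
    exact ⟨hF, x.superset_mem (x.inter_mem hE hF') (preimage_mem_ring ζ hF)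
      fun μ ⟨h1, n, h2, h3⟩ => ⟨n, (h μ h1 n).2 h2, h3⟩⟩

theorem dom_append_mem {a b c : C} (ζ : Zigzag a b) (ξ : Zigzag b c) (x : Spec c)
    (hξ : ξ.dom ∈ x.sets) (hζ : ζ.dom ∈ (map ξ x hξ).sets) : (ζ.append ξ).dom ∈ x.sets := by
  refine x.superset_mem hζ.2 (dom_mem_ring _) ?_
  rintro μ ⟨n, h1, k, h2⟩
  exact ⟨k, (Zigzag.rel_append _ _ _ _).2 ⟨n, h1, h2⟩⟩

theorem map_append {a b c : C} (ζ : Zigzag a b) (ξ : Zigzag b c) (x : Spec c)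
    (hξ : ξ.dom ∈ x.sets) (hζ : ζ.dom ∈ (map ξ x hξ).sets) (h : (ζ.append ξ).dom ∈ x.sets) :
    map (ζ.append ξ) x h = map ζ (map ξ x hξ) hζ := by
  have key : ∀ E, (ζ.append ξ).preimage E = ξ.preimage (ζ.preimage E) := by
    intro E
    ext μ
    constructor
    · rintro ⟨k, h1, h2⟩
      obtain ⟨n, h3, h4⟩ := (Zigzag.rel_append _ _ _ _).1 h1
      exact ⟨n, h3, k, h4, h2⟩
    · rintro ⟨n, h3, k, h4, h2⟩
      exact ⟨k, (Zigzag.rel_append _ _ _ _).2 ⟨n, h3, h4⟩, h2⟩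
  ext E
  constructor
  · rintro ⟨hE, hE'⟩
    exact ⟨hE, preimage_mem_ring ζ hE, key E ▸ hE'⟩
  · rintro ⟨hE, -, hE'⟩
    exact ⟨hE, (key E).symm ▸ hE'⟩

theorem dom_reverse_mem {a b : C} (ζ : Zigzag a b) (x : Spec b) (hx : ζ.dom ∈ x.sets) :
    ζ.reverse.dom ∈ (map ζ x hx).sets := by
  refine ⟨dom_mem_ring _, x.superset_mem hx (preimage_mem_ring ζ (dom_mem_ring _)) ?_⟩
  rintro μ ⟨n, hn⟩
  exact ⟨n, hn, μ.2, (Zigzag.rel_reverse _ _ _).2 hn⟩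

theorem map_reverse {a b : C} (ζ : Zigzag a b) (x : Spec b) (hx : ζ.dom ∈ x.sets)
    (h : ζ.reverse.dom ∈ (map ζ x hx).sets) : map ζ.reverse (map ζ x hx) h = x := by
  ext E
  constructor
  · rintro ⟨hE, -, hE'⟩
    refine x.superset_mem hE' hE ?_
    rintro ⟨z, m⟩ ⟨n, h1, m', h2, h3⟩
    have h4 : ζ.reverse.Rel n m := (Zigzag.rel_reverse _ _ _).2 h1
    have h5 := ζ.reverse.rel_unique h4 h2
    subst h5
    exact h3
  · intro hE
    have hE' := x.mem_ring hE
    refine ⟨hE', preimage_mem_ring _ hE',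
      x.superset_mem (x.inter_mem hE hx) (preimage_mem_ring _ (preimage_mem_ring _ hE')) ?_⟩
    rintro μ ⟨h1, n, h2⟩
    exact ⟨n, h2, μ.2, (Zigzag.rel_reverse _ _ _).2 h2, h1⟩

theorem map_congr {a b : C} (ζ : Zigzag a b) {x y : Spec b} (e : x = y) (hx : ζ.dom ∈ x.sets)
    (hy : ζ.dom ∈ y.sets) : map ζ x hx = map ζ y hy := by
  subst e
  rfl

/-- `Φ_ζ` and `Φ_ξ` are defined and agree on some neighbourhood of `x`. -/
def AgreeNear {a b : C} (x : Spec b) (ζ ξ : Zigzag a b) : Prop :=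
  ∃ U ∈ 𝓝 x, ∀ y ∈ U, ∃ (h : ζ.dom ∈ y.sets) (h' : ξ.dom ∈ y.sets), map ζ y h = map ξ y h'

theorem agreeNear_of_rel_iff {a b : C} (ζ ξ : Zigzag a b) (x : Spec b) (hζ : ζ.dom ∈ x.sets)
    (hξ : ξ.dom ∈ x.sets) (E : Set (PathsTo b)) (hE : E ∈ x.sets)
    (h : ∀ μ ∈ E, ∀ n, ζ.Rel μ.2 n ↔ ξ.Rel μ.2 n) : AgreeNear x ζ ξ := by
  have hD := inter_mem x (inter_mem x hζ hξ) hE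
  refine ⟨hat ((ζ.dom ∩ ξ.dom) ∩ E), (mem_nhds_iff x _).2 ⟨_, hD, subset_rfl⟩, fun y hy => ?_⟩
  have h1 : ζ.dom ∈ y.sets := y.superset_mem hy (dom_mem_ring _) fun μ hμ => hμ.1.1
  have h2 : ξ.dom ∈ y.sets := y.superset_mem hy (dom_mem_ring _) fun μ hμ => hμ.1.2
  have h3 : E ∈ y.sets := y.superset_mem hy (x.mem_ring hE) fun μ hμ => hμ.2
  exact ⟨h1, h2, map_eq_of_rel_iff ζ ξ y h1 h2 E h3 h⟩

theorem AgreeNear.refl {a b : C} (x : Spec b) (ζ : Zigzag a b) (h : ζ.dom ∈ x.sets) :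
    AgreeNear x ζ ζ :=
  agreeNear_of_rel_iff ζ ζ x h h _ h fun _ _ _ => Iff.rfl

theorem AgreeNear.symm {a b : C} {x : Spec b} {ζ ξ : Zigzag a b} (h : AgreeNear x ζ ξ) :
    AgreeNear x ξ ζ := by
  obtain ⟨U, hU, h⟩ := h
  refine ⟨U, hU, fun y hy => ?_⟩
  obtain ⟨h1, h2, h3⟩ := h y hy
  exact ⟨h2, h1, h3.symm⟩

theorem AgreeNear.trans {a b : C} {x : Spec b} {ζ ξ η : Zigzag a b} (h : AgreeNear x ζ ξ)
    (h' : AgreeNear x ξ η) : AgreeNear x ζ η := by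
  obtain ⟨U, hU, h⟩ := h
  obtain ⟨V, hV, h'⟩ := h'
  refine ⟨U ∩ V, Filter.inter_mem hU hV, fun y hy => ?_⟩
  obtain ⟨h1, h2, h3⟩ := h y hy.1
  obtain ⟨h1', h2', h3'⟩ := h' y hy.2
  exact ⟨h1, h2', h3.trans h3'⟩

theorem AgreeNear.append {a b c : C} {x : Spec c} {ξ ξ' : Zigzag b c} (hξ : ξ.dom ∈ x.sets)
    (h : AgreeNear x ξ ξ') {ζ ζ' : Zigzag a b} (h' : AgreeNear (map ξ x hξ) ζ ζ') :
    AgreeNear x (ζ.append ξ) (ζ'.append ξ') := by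
  obtain ⟨U, hU, h⟩ := h
  obtain ⟨V, hV, h'⟩ := h'
  obtain ⟨E, hE, hEV⟩ := (mem_nhds_iff _ _).1 hV
  have hW : hat (ξ.preimage E) ∈ 𝓝 x := (mem_nhds_iff _ _).2 ⟨_, hE.2, subset_rfl⟩
  refine ⟨U ∩ hat (ξ.preimage E), Filter.inter_mem hU hW, fun y hy => ?_⟩
  obtain ⟨h1, h2, h3⟩ := h y hy.1
  obtain ⟨h4, h5, h6⟩ := h' (map ξ y h1) (hEV ⟨hE.1, hy.2⟩)
  have h5' : ζ'.dom ∈ (map ξ' y h2).sets := h3 ▸ h5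
  refine ⟨dom_append_mem _ _ y h1 h4, dom_append_mem _ _ y h2 h5', ?_⟩
  rw [map_append _ _ y h1 h4, map_append _ _ y h2 h5', h6]
  exact map_congr ζ' h3 h5 h5'

theorem AgreeNear.degree_eq {Q : Type w} [AddCommGroup Q] (ψ : DegreeFunctor C Q) {a b : C}
    {x : Spec b} {ζ ξ : Zigzag a b} (h : AgreeNear x ζ ξ) : ζ.degree ψ = ξ.degree ψ := by
  obtain ⟨U, hU, h⟩ := h
  obtain ⟨E, hE, hEU⟩ := (mem_nhds_iff _ _).1 hU
  obtain ⟨⟨z, m⟩, hμ⟩ := x.nonempty_of_mem hE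
  obtain ⟨h1, h2, h3⟩ := h (fixed ⟨z, m⟩) (hEU ⟨x.mem_ring hE, hμ⟩)
  obtain ⟨n, hn⟩ := h1.2
  obtain ⟨n', hn'⟩ := h2.2
  rw [map_fixed ζ m n hn, map_fixed ξ m n' hn'] at h3
  obtain rfl := fixed_injective h3
  rw [Zigzag.degree_of_rel ψ ζ hn, Zigzag.degree_of_rel ψ ξ hn']

end Spec

/-! ### The groupoid of a category of paths -/

/-- The space `X = ⨆_v X_v` (disjoint union), which is the unit space of the groupoid. -/
def PathSpace (C : Type u) [SmallCategory C] : Type u := Σ v : C, Spec v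

instance (C : Type u) [SmallCategory C] : TopologicalSpace (PathSpace C) :=
  inferInstanceAs (TopologicalSpace (Σ v : C, Spec v))

section PathGroupoid

variable {C : Type u} [SmallCategory C] [CategoryOfPaths C]

/-- The zigzags `ζ` such that `Φ_ζ(x)` is defined and equals `y`. -/
def ZigzagFromTo (x y : PathSpace C) : Type u :=
  {ζ : Zigzag y.1 x.1 // ∃ h : ζ.dom ∈ x.2.sets, Spec.map ζ x.2 h = y.2}

/-- `(ζ, x) ∼ (ξ, x)` if `Φ_ζ = Φ_ξ` near `x`. -/
instance germSetoid (x y : PathSpace C) : Setoid (ZigzagFromTo x y) where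
  r ζ ξ := Spec.AgreeNear x.2 ζ.1 ξ.1
  iseqv := ⟨fun ζ => Spec.AgreeNear.refl _ _ ζ.2.1, Spec.AgreeNear.symm, Spec.AgreeNear.trans⟩

/-- The elements `[ζ, x]` of the groupoid with source `x` and range `Φ_ζ(x) = y`. -/
def Germ (x y : PathSpace C) : Type u := Quotient (germSetoid x y)

namespace ZigzagFromTo

/-- Concatenation. -/
def append {x y z : PathSpace C} (ξ : ZigzagFromTo x y) (ζ : ZigzagFromTo y z) :
    ZigzagFromTo x z :=
  ⟨ζ.1.append ξ.1, by
    obtain ⟨ξ, h, e⟩ := ξ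
    obtain ⟨ζ, h', e'⟩ := ζ
    have h2 : ζ.dom ∈ (Spec.map ξ x.2 h).sets := e ▸ h'
    exact ⟨Spec.dom_append_mem ζ ξ x.2 h h2, (Spec.map_append ζ ξ x.2 h h2 _).trans
      ((Spec.map_congr ζ e h2 h').trans e')⟩⟩

/-- The trivial zigzag `(v, v)` at `x ∈ X_v`. -/
def unit (x : PathSpace C) : ZigzagFromTo x x :=
  ⟨Zigzag.single (𝟙 x.1) (𝟙 x.1), by
    have hd : (Zigzag.single (𝟙 x.1) (𝟙 x.1)).dom = Set.univ :=
      Set.eq_univ_of_forall fun μ => ⟨μ.2, rfl⟩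
    have hp : ∀ E, (Zigzag.single (𝟙 x.1) (𝟙 x.1)).preimage E = E := by
      intro E
      ext μ
      constructor
      · rintro ⟨n, h1, h2⟩
        have h3 : μ.2 = n := by simpa [Zigzag.Rel] using h1
        obtain ⟨_, m⟩ := μ
        obtain rfl : m = n := h3
        exact h2
      · exact fun h => ⟨μ.2, rfl, h⟩
    refine ⟨hd ▸ x.2.univ_mem, ?_⟩
    ext E
    constructor
    · rintro ⟨-, h⟩
      rwa [hp] at h
    · intro h
      refine ⟨x.2.mem_ring h, ?_⟩
      rwa [hp]⟩

/-- Reversal. -/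
def reverse {x y : PathSpace C} (ζ : ZigzagFromTo x y) : ZigzagFromTo y x :=
  ⟨ζ.1.reverse, by
    obtain ⟨ζ, h, e⟩ := ζ
    have h1 := Spec.dom_reverse_mem ζ x.2 h
    have h2 : ζ.reverse.dom ∈ y.2.sets := e ▸ h1
    exact ⟨h2, (Spec.map_congr ζ.reverse e.symm h2 h1).trans (Spec.map_reverse ζ x.2 h h1)⟩⟩

theorem append_equiv {x y z : PathSpace C} {ξ ξ' : ZigzagFromTo x y} {ζ ζ' : ZigzagFromTo y z}
    (h : ξ ≈ ξ') (h' : ζ ≈ ζ') : ξ.append ζ ≈ ξ'.append ζ' := by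
  obtain ⟨ξ, h1, e⟩ := ξ
  have h2 : Spec.AgreeNear (Spec.map ξ x.2 h1) ζ.1 ζ'.1 :=
    e.symm ▸ (show Spec.AgreeNear y.2 ζ.1 ζ'.1 from h')
  exact Spec.AgreeNear.append h1 h h2

theorem equiv_of_rel_iff {x y : PathSpace C} (ζ ξ : ZigzagFromTo x y) (E : Set (PathsTo x.1))
    (hE : E ∈ x.2.sets) (h : ∀ μ ∈ E, ∀ n, ζ.1.Rel μ.2 n ↔ ξ.1.Rel μ.2 n) : ζ ≈ ξ :=
  Spec.agreeNear_of_rel_iff ζ.1 ξ.1 x.2 ζ.2.1 ξ.2.1 E hE h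

end ZigzagFromTo

namespace Germ

/-- The germ `[ζ, x]`. -/
def mk {x y : PathSpace C} (ζ : ZigzagFromTo x y) : Germ x y := Quotient.mk (germSetoid x y) ζ

/-- `[ζ, Φ_ξ(x)] [ξ, x] = [ζξ, x]`. -/
def mul {x y z : PathSpace C} (g : Germ x y) (h : Germ y z) : Germ x z :=
  Quotient.map₂ ZigzagFromTo.append (fun _ _ h1 _ _ h2 => ZigzagFromTo.append_equiv h1 h2) g h

theorem mk_reverse_mul {x y : PathSpace C} (ζ : ZigzagFromTo x y) :
    mul (mk ζ) (mk ζ.reverse) = (mk (ZigzagFromTo.unit x)) := by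
  refine Quotient.sound (ZigzagFromTo.equiv_of_rel_iff _ _ ζ.1.dom ζ.2.1 ?_)
  rintro ⟨z, m⟩ ⟨k, hk⟩ n
  constructor
  · intro h
    obtain ⟨l, h1, h2⟩ := (Zigzag.rel_append _ _ _ _).1 h
    have h3 : ζ.1.Rel n l := (Zigzag.rel_reverse _ _ _).1 h2
    have h4 : ζ.1.reverse.Rel l m := (Zigzag.rel_reverse _ _ _).2 h1
    have h5 : m = n := ζ.1.reverse.rel_unique h4 h2
    subst h5
    rfl
  · intro h
    have h1 : m = n := by simpa [ZigzagFromTo.unit, Zigzag.Rel] using h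
    subst h1
    exact (Zigzag.rel_append _ _ _ _).2 ⟨k, hk, (Zigzag.rel_reverse _ _ _).2 hk⟩

theorem reverse_mul_mk {x y : PathSpace C} (ζ : ZigzagFromTo x y) :
    mul (mk ζ.reverse) (mk ζ) = (mk (ZigzagFromTo.unit y)) := by
  refine Quotient.sound (ZigzagFromTo.equiv_of_rel_iff _ _ _ ζ.reverse.2.1 ?_)
  rintro ⟨z, m⟩ ⟨k, hk⟩ n
  have hk' : ζ.1.Rel k m := (Zigzag.rel_reverse _ _ _).1 hk
  constructor
  · intro h
    obtain ⟨l, h1, h2⟩ := (Zigzag.rel_append _ _ _ _).1 h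
    have h3 : ζ.1.Rel l m := (Zigzag.rel_reverse _ _ _).1 h1
    have h5 : m = n := ζ.1.rel_unique h3 h2
    subst h5
    rfl
  · intro h
    have h1 : m = n := by simpa [ZigzagFromTo.unit, Zigzag.Rel] using h
    subst h1
    exact (Zigzag.rel_append _ _ _ _).2 ⟨k, hk, hk'⟩

theorem mul_assoc' {x y z t : PathSpace C} (f : Germ x y) (g : Germ y z) (h : Germ z t) :
    mul (mul f g) h = mul f (mul g h) := by
  refine Quotient.inductionOn₃ f g h fun f g h => ?_
  refine Quotient.sound (ZigzagFromTo.equiv_of_rel_iff _ _ Set.univ x.2.univ_mem ?_)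
  intro μ _ n
  simp only [ZigzagFromTo.append, Zigzag.rel_append]
  constructor
  · rintro ⟨k, ⟨l, h1, h2⟩, h3⟩
    exact ⟨l, h1, k, h2, h3⟩
  · rintro ⟨l, h1, k, h2, h3⟩
    exact ⟨k, ⟨l, h1, h2⟩, h3⟩

theorem unit_mul {x y : PathSpace C} (f : Germ x y) :
    mul (mk (ZigzagFromTo.unit x)) f = f := by
  refine Quotient.inductionOn f fun f => ?_
  refine Quotient.sound (ZigzagFromTo.equiv_of_rel_iff _ _ Set.univ x.2.univ_mem ?_)
  intro μ _ n
  simp [ZigzagFromTo.append, ZigzagFromTo.unit, Zigzag.rel_append, Zigzag.Rel]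

theorem mul_unit {x y : PathSpace C} (f : Germ x y) :
    mul f (mk (ZigzagFromTo.unit y)) = f := by
  refine Quotient.inductionOn f fun f => ?_
  refine Quotient.sound (ZigzagFromTo.equiv_of_rel_iff _ _ Set.univ x.2.univ_mem ?_)
  intro μ _ n
  simp [ZigzagFromTo.append, ZigzagFromTo.unit, Zigzag.rel_append, Zigzag.Rel]

theorem reverse_equiv {x y : PathSpace C} (ζ ξ : ZigzagFromTo x y) (h : ζ ≈ ξ) :
    ζ.reverse ≈ ξ.reverse := by
  have e : mk ζ = mk ξ := Quotient.sound h
  have h1 : mk ζ.reverse = mk ξ.reverse := by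
    rw [← mul_unit (mk ζ.reverse), ← mk_reverse_mul ξ, ← e, ← mul_assoc',
      reverse_mul_mk ζ, unit_mul]
  exact Quotient.exact h1

/-- `[ζ, x]⁻¹ = [ζ̄, Φ_ζ(x)]`. -/
def inv {x y : PathSpace C} (g : Germ x y) : Germ y x :=
  Quotient.map ZigzagFromTo.reverse reverse_equiv g

end Germ

/-- The groupoid `G` of the category of paths, with unit space `X`.  A morphism `x ⟶ y` is a germ
`[ζ, x]` with `Φ_ζ(x) = y`; the groupoid product `gh` is `h ≫ g`. -/
instance pathGroupoid : Groupoid.{u, u} (PathSpace C) where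
  Hom := Germ
  id x := Germ.mk (ZigzagFromTo.unit x)
  comp := Germ.mul
  id_comp := Germ.unit_mul
  comp_id := Germ.mul_unit
  assoc := Germ.mul_assoc'
  inv := Germ.inv
  inv_comp g := Quotient.inductionOn g Germ.reverse_mul_mk
  comp_inv g := Quotient.inductionOn g Germ.mk_reverse_mul

/-- The element `[ζ, x]` of `G`, where `x ∈ X_{s(ζ)}` with `A(ζ) ∈ 𝒰_x`. -/
def germ {a b : C} (ζ : Zigzag a b) (x : Spec b) (h : ζ.dom ∈ x.sets) :
    Quiver.Total (PathSpace C) :=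
  ⟨⟨b, x⟩, ⟨a, Spec.map ζ x h⟩, Germ.mk ⟨ζ, h, rfl⟩⟩

/-- The set `[ζ, E] = {[ζ, x] : x ∈ Ê}` (for those `x` for which `[ζ, x]` makes sense). -/
def germSet {a b : C} (ζ : Zigzag a b) (E : Set (PathsTo b)) : Set (Quiver.Total (PathSpace C)) :=
  {g | ∃ (x : Spec b) (h : ζ.dom ∈ x.sets), E ∈ x.sets ∧ g = germ ζ x h}

/-- The topology of `G`, with base the sets `[ζ, E]`, `E ∈ 𝒜_{s(ζ)}`. -/
instance pathGroupoidTopology : TopologicalSpace (Quiver.Total (PathSpace C)) :=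
  TopologicalSpace.generateFrom
    {W | ∃ (a b : C) (ζ : Zigzag a b), ∃ E ∈ ring b, W = germSet ζ E}

/-- The cocycle `c_ψ([ζ, x]) = ∑ᵢ ψ(βᵢ) - ψ(αᵢ)`, `ζ = (α₁, β₁, …, αₙ, βₙ)`. -/
def cocycle {Q : Type w} [AddCommGroup Q] (ψ : DegreeFunctor C Q) {x y : PathSpace C}
    (g : x ⟶ y) : Q :=
  Quotient.lift (s := germSetoid x y) (fun ζ => ζ.1.degree ψ)
    (fun _ _ h => Spec.AgreeNear.degree_eq ψ h) g

/-- The fixed point groupoid `G^ψ = c_ψ⁻¹(0)`. -/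
def fixedPointGroupoid {Q : Type w} [AddCommGroup Q] (ψ : DegreeFunctor C Q) :
    Subgroupoid (PathSpace C) where
  arrows x y := {g | cocycle ψ g = 0}
  inv := by
    intro x y g
    refine Quotient.inductionOn g fun ζ (h : ζ.1.degree ψ = 0) => ?_
    show ζ.1.reverse.degree ψ = 0
    rw [Zigzag.degree_reverse, h, neg_zero]
  mul := by
    intro x y z g hg k hk
    revert hg hk
    refine Quotient.inductionOn₂ g k fun ξ ζ (h : ξ.1.degree ψ = 0) (h' : ζ.1.degree ψ = 0) => ?_
    show (ζ.1.append ξ.1).degree ψ = 0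
    rw [Zigzag.degree_append, h, h', zero_add]

end PathGroupoid

/-! ### AF groupoids

A topological groupoid is a groupoid together with a topology on its set `Quiver.Total G` of all
arrows. -/

/-- The topology on (the arrows of) a subgroupoid is the relative topology. -/
instance subgroupoidTopology {G : Type u} [Groupoid.{u} G] [TopologicalSpace (Quiver.Total G)]
    (S : Subgroupoid G) : TopologicalSpace (Quiver.Total S.objs) :=
  TopologicalSpace.induced
    (fun g => (⟨g.left.1, g.right.1, g.hom.1⟩ : Quiver.Total G)) inferInstance

/-- The unit space `G⁰`, as a subset of (and with the relative topology from) the set of arrows. -/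
def unitSpace (G : Type u) [Groupoid.{u} G] : Set (Quiver.Total G) :=
  Set.range fun x : G => (⟨x, x, 𝟙 x⟩ : Quiver.Total G)

/-- An elementary groupoid: as a topological groupoid, it is isomorphic to a disjoint union of a
sequence of groupoids `Y i × (Fin (n i) × Fin (n i))`, where `Y i` is a space (regarded as a groupoid
consisting of units) and `Fin (n i) × Fin (n i)` is the transitive principal groupoid on `n i`
points.  Here `u i` and `m i` are the maps of units and arrows, `m i y j k` being the image of the
arrow from `(y, j)` to `(y, k)`. -/
def IsElementaryGroupoid (G : Type u) [Groupoid.{u} G] [TopologicalSpace (Quiver.Total G)] : Prop :=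
  ∃ (Y : ℕ → Type u) (_ : ∀ i, TopologicalSpace (Y i)) (n : ℕ → ℕ)
    (u : ∀ i, Y i → Fin (n i) → G)
    (m : ∀ (i : ℕ) (y : Y i) (j k : Fin (n i)), u i y j ⟶ u i y k),
    (∀ i y j k l, m i y j k ≫ m i y k l = m i y j l) ∧
    IsHomeomorph (fun p : Σ i, Y i × Fin (n i) × Fin (n i) =>
      (⟨_, _, m p.1 p.2.1 p.2.2.1 p.2.2.2⟩ : Quiver.Total G))

/-- An AF groupoid: the unit space is a second countable, locally compact, Hausdorff, totally
disconnected space, and the groupoid is the inductive limit of a sequence of elementary groupoids,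
that is, the union of an increasing sequence of open elementary subgroupoids with the same unit
space. -/
def IsAFGroupoid (G : Type u) [Groupoid.{u} G] [TopologicalSpace (Quiver.Total G)] : Prop :=
  T2Space (unitSpace G) ∧ LocallyCompactSpace (unitSpace G) ∧
  SecondCountableTopology (unitSpace G) ∧ TotallyDisconnectedSpace (unitSpace G) ∧
  ∃ H : ℕ → Subgroupoid G, Monotone H ∧ (∀ i, (H i).IsWide) ∧
    (∀ i, IsOpen {g : Quiver.Total G | g.hom ∈ (H i).arrows g.left g.right}) ∧
    (∀ g : Quiver.Total G, ∃ i, g.hom ∈ (H i).arrows g.left g.right) ∧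
    ∀ i, IsElementaryGroupoid (H i).objs

end PathCat

open PathCat

namespace PathCat

/-! ### Initial segments and minimal common extensions. -/

section PathOrder

variable {C : Type u} [SmallCategory C]

/-! Fix a finite set T of degrees as in condition (2), containing 0. For an ultrafilter x, condition
(1) leaves only finitely many paths of degree in T whose extension sets belong to x. Their minimal
common extensions have degree in T by (2), and the extension set of one of them belongs to x. So x
has a longest initial segment with degree in T (`exists_isTop`). A map δk ↦ γk with ψ(δ) = ψ(γ) ∈ T
carries the longest segment ηδ to the longest segment ηγ (`IsTop.map_swap`). If such a map fixes x,
then ηγ = ηδ and hence γ = δ. As every zigzag map is locally of the form δk ↦ γk, the groupoid G^ψ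
is principal (`hom_eq_of_cocycle_eq_zero`).

There are countably many pairs (γ, δ) of equal degree, so G^ψ is the increasing union of the open
subgroupoids given by the orbit relations of finite sets S of such pairs. These relations have
finite classes (`OrbitRel.finite`). Indeed an infinite orbit lies in a compact set and accumulates
at some z. The longest segment has constant degree along the orbit and a different degree at z:
otherwise, by nondegeneracy, all orbit points near z would share the longest segment of z, and two
points of an orbit with the same longest segment coincide. The orbit of z is infinite again, and its
accumulation points are accumulation points of the first orbit. So the set of degrees occurring at
accumulation points with infinite orbit, a subset of T, shrinks strictly on passing to z, and this
cannot go on forever.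

When an orbit is finite, principality makes the orbit structure locally constant: a clopen
neighbourhood and finitely many disjoint translates of it sweep out all nearby orbits
(`exists_tower`). Countably many such towers, made disjoint, exhibit the orbit groupoid as
elementary (`isElementaryGroupoid_of_towers`). -/

theorem mem_tails_iff {a b c : C} (α : a ⟶ b) (γ : c ⟶ b) :
    (⟨c, b, γ⟩ : PathSet C) ∈ tails ⟨a, b, α⟩ ↔ ∃ k : c ⟶ a, k ≫ α = γ := by
  constructor
  · rintro ⟨β, x, y, z, f, g, h1, h2, h3⟩
    cases h1
    cases h3
    exact ⟨g, rfl⟩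
  · rintro ⟨k, rfl⟩
    exact ⟨⟨c, a, k⟩, c, a, b, α, k, rfl, rfl, rfl⟩

theorem right_eq_of_mem_tails {α γ : PathSet C} (h : γ ∈ tails α) : γ.right = α.right := by
  obtain ⟨β, x, y, z, f, g, rfl, rfl, rfl⟩ := h
  rfl

theorem self_mem_tails (α : PathSet C) : α ∈ tails α :=
  (mem_tails_iff α.hom α.hom).2 ⟨𝟙 _, Category.id_comp _⟩

theorem tails_subset {α β : PathSet C} (h : β ∈ tails α) : tails β ⊆ tails α := by
  obtain ⟨a, b, f⟩ := α
  obtain ⟨c, b', g⟩ := β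
  obtain rfl : b' = b := right_eq_of_mem_tails h
  rintro ⟨d, b'', k⟩ hk
  obtain rfl : b'' = b' := right_eq_of_mem_tails hk
  obtain ⟨p, rfl⟩ := (mem_tails_iff _ _).1 h
  obtain ⟨q, rfl⟩ := (mem_tails_iff _ _).1 hk
  exact (mem_tails_iff _ _).2 ⟨q ≫ p, Category.assoc _ _ _⟩

theorem exists_finite_iInter_tails (hfa : FinitelyAligned C) {F : Set (PathSet C)}
    (hF : F.Finite) (hne : F.Nonempty) :
    ∃ G : Set (PathSet C), G.Finite ∧ ⋂ α ∈ F, tails α = ⋃ ε ∈ G, tails ε := by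
  induction F, hF using Set.Finite.induction_on with
  | empty => exact absurd hne Set.not_nonempty_empty
  | @insert α F _ _ ih =>
    rcases F.eq_empty_or_nonempty with rfl | hF
    · exact ⟨{α}, Set.finite_singleton _, by simp⟩
    · obtain ⟨G, hG, e⟩ := ih hF
      choose K hK hK' using hfa α
      refine ⟨⋃ ε ∈ G, K ε, hG.biUnion fun ε _ => hK ε, ?_⟩
      rw [Set.biInter_insert, e, Set.inter_iUnion₂, Set.biUnion_iUnion]
      refine Set.iUnion_congr fun ε => ?_
      rw [Set.biUnion_iUnion]
      exact Set.iUnion_congr fun _ => hK' ε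

variable [CategoryOfPaths C]

/-- Antisymmetry of extension: the two factors are mutually inverse by left cancellation, hence
identities because there are no inverses. -/
theorem pathsTo_ext_of_factor {u u' v : C} {e : u ⟶ v} {e' : u' ⟶ v} (k : u ⟶ u') (l : u' ⟶ u)
    (hk : k ≫ e' = e) (hl : l ≫ e = e') : (⟨u, e⟩ : PathsTo v) = ⟨u', e'⟩ := by
  have h : k ≫ l = 𝟙 u := CategoryOfPaths.left_cancel e _ _ (by
    rw [Category.assoc, hl, hk, Category.id_comp])
  obtain ⟨rfl, rfl, rfl⟩ := CategoryOfPaths.no_inverses l k h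
  simpa using hl

theorem tails_antisymm {α β : PathSet C} (h : β ∈ tails α) (h' : α ∈ tails β) : α = β := by
  obtain ⟨a, b, f⟩ := α
  obtain ⟨c, b', g⟩ := β
  obtain rfl : b' = b := right_eq_of_mem_tails h
  obtain ⟨p, hp⟩ := (mem_tails_iff _ _).1 h
  obtain ⟨q, hq⟩ := (mem_tails_iff _ _).1 h'
  cases pathsTo_ext_of_factor q p hq hp
  rfl

/-- In a finitely aligned category of paths a finite nonempty set of paths has finitely many minimal
common extensions, and each common extension extends one of them. -/
theorem minCommonExt_finite_and_cofinal (hfa : FinitelyAligned C) {F : Set (PathSet C)}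
    (hF : F.Finite) (hne : F.Nonempty) :
    (minCommonExt F).Finite ∧ ∀ γ ∈ ⋂ α ∈ F, tails α, ∃ ε ∈ minCommonExt F, γ ∈ tails ε := by
  obtain ⟨G, hG, e⟩ := exists_finite_iInter_tails hfa hF hne
  -- With extension as a local order, every element of the finite generating set `G` lies above a
  -- minimal one. Minimality in `G` is then minimality among all common extensions, since `G` is
  -- cofinal.
  let : PartialOrder (PathSet C) :=
    { le := fun α β => β ∈ tails α
      le_refl := self_mem_tails
      le_trans := fun α β γ h h' => tails_subset h h'
      le_antisymm := fun α β h h' => tails_antisymm h h' }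
  have hGsub : ∀ ε ∈ G, ε ∈ ⋂ α ∈ F, tails α := fun ε hε => by
    rw [e]
    exact Set.mem_biUnion hε (self_mem_tails ε)
  have hGcov : ∀ γ ∈ ⋂ α ∈ F, tails α, ∃ ε ∈ G, γ ∈ tails ε := fun γ hγ => by
    rw [e] at hγ
    simpa using hγ
  refine ⟨hG.subset fun γ hγ => ?_, fun γ hγ => ?_⟩
  · obtain ⟨ε, hε, h⟩ := hGcov γ hγ.1
    exact hγ.2 ε (hGsub ε hε) h ▸ hε
  · obtain ⟨ε, hε, h⟩ := hGcov γ hγ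
    obtain ⟨ε', hle, hmin⟩ := hG.exists_le_minimal hε
    refine ⟨ε', ⟨hGsub ε' hmin.1, fun δ hδ hδε => ?_⟩, tails_subset hle h⟩
    obtain ⟨ε'', hε'', h''⟩ := hGcov δ hδ
    have h2 : ε' ∈ tails ε'' := tails_subset h'' hδε
    have h3 : ε'' ∈ tails ε' := hmin.2 hε'' h2
    exact tails_antisymm hδε (tails_subset h3 h'')

end PathOrder

/-! ### Zigzag maps as finite unions of maps δk ↦ γk. -/

section Decomposition

variable {C : Type u} [SmallCategory C]

/-- A pair of paths with common source. -/
abbrev Span (a b : C) : Type u := Σ u : C, (u ⟶ a) × (u ⟶ b)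

/-- `s.Rel m n`: the partial map taking `δk` to `γk` takes `m` to `n`, where `s = (γ, δ)`. -/
def Span.Rel {a b : C} (s : Span a b) {x : C} (m : x ⟶ b) (n : x ⟶ a) : Prop :=
  ∃ k : x ⟶ s.1, k ≫ s.2.2 = m ∧ k ≫ s.2.1 = n

variable [CategoryOfPaths C]

/-- A solution of `m ≫ β = n ≫ α` is a common extension of α and β. It extends one of the finitely
many generators of the intersection, and each generator, factored through α and through β, is a
span. -/
theorem exists_finite_spans_of_cospan (hfa : FinitelyAligned C) {a b c : C} (α : a ⟶ c)
    (β : b ⟶ c) :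
    ∃ D : Set (Span a b), D.Finite ∧ ∀ {x : C} (m : x ⟶ b) (n : x ⟶ a),
      m ≫ β = n ≫ α ↔ ∃ s ∈ D, s.Rel m n := by
  obtain ⟨G, hG, e⟩ := hfa ⟨a, c, α⟩ ⟨b, c, β⟩
  have hmem : ∀ ε : G, ∃ s : Span a b, s.2.2 ≫ β = s.2.1 ≫ α ∧
      (⟨s.1, c, s.2.1 ≫ α⟩ : PathSet C) = ε := by
    rintro ⟨ε, hε⟩
    have h : ε ∈ tails ⟨a, c, α⟩ ∩ tails ⟨b, c, β⟩ := by
      rw [e]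
      exact Set.mem_biUnion hε (self_mem_tails ε)
    obtain ⟨u, c', f⟩ := ε
    obtain rfl : c' = c := right_eq_of_mem_tails h.1
    obtain ⟨p, rfl⟩ := (mem_tails_iff _ _).1 h.1
    obtain ⟨q, hq⟩ := (mem_tails_iff _ _).1 h.2
    exact ⟨⟨u, p, q⟩, hq, rfl⟩
  choose s hs hs' using hmem
  have := hG.to_subtype
  refine ⟨Set.range s, Set.finite_range s, fun {x} m n => ⟨fun h => ?_, ?_⟩⟩
  · have h1 : (⟨x, c, n ≫ α⟩ : PathSet C) ∈ ⋃ ε ∈ G, tails ε := by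
      rw [← e]
      exact ⟨(mem_tails_iff _ _).2 ⟨n, rfl⟩, (mem_tails_iff _ _).2 ⟨m, h⟩⟩
    obtain ⟨ε, hε, h2⟩ := Set.mem_iUnion₂.1 h1
    replace h2 : (⟨x, c, n ≫ α⟩ : PathSet C) ∈ tails (⟨ε, hε⟩ : G).1 := h2
    rw [← hs'] at h2
    obtain ⟨k, hk⟩ := (mem_tails_iff _ _).1 h2
    refine ⟨_, ⟨⟨ε, hε⟩, rfl⟩, k, ?_, ?_⟩
    · apply CategoryOfPaths.left_cancel β
      rw [Category.assoc, hs, hk, h]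
    · apply CategoryOfPaths.left_cancel α
      rw [Category.assoc, hk]
  · rintro ⟨_, ⟨ε, rfl⟩, k, rfl, rfl⟩
    rw [Category.assoc, Category.assoc, hs]

/-- Every zigzag map of a finitely aligned category of paths is a finite union of maps `δk ↦ γk`. -/
theorem Zigzag.exists_finite_spans (hfa : FinitelyAligned C) {a b : C} (ζ : Zigzag a b) :
    ∃ D : Set (Span a b), D.Finite ∧ ∀ {x : C} (m : x ⟶ b) (n : x ⟶ a),
      ζ.Rel m n ↔ ∃ s ∈ D, s.Rel m n := by
  induction ζ with
  | single α β => exact exists_finite_spans_of_cospan hfa α β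
  | @cons a b c d α β ζ ih =>
    obtain ⟨D, hD, h⟩ := ih
    obtain ⟨D', hD', h'⟩ := exists_finite_spans_of_cospan hfa α β
    -- To compose the map of `s` with that of `t`, the output leg of `s` must meet the input leg of
    -- `t`; finite alignment applied to these two legs gives the composite spans.
    choose P hP hP' using fun (s : Span b d) (t : Span a b) =>
      exists_finite_spans_of_cospan hfa s.2.1 t.2.2
    refine ⟨⋃ s ∈ D, ⋃ t ∈ D', (fun p : Span s.1 t.1 =>
      (⟨p.1, p.2.2 ≫ t.2.1, p.2.1 ≫ s.2.2⟩ : Span a d)) '' P s t,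
      hD.biUnion fun s _ => hD'.biUnion fun t _ => (hP s t).image _, fun {x} m n => ?_⟩
    simp only [Set.mem_iUnion, Set.mem_image, exists_prop]
    constructor
    · rintro ⟨k, h1, h2⟩
      obtain ⟨s, hs, i, rfl, rfl⟩ := (h _ _).1 h1
      obtain ⟨t, ht, j, h3, rfl⟩ := (h' _ _).1 h2
      obtain ⟨p, hp, l, rfl, rfl⟩ := (hP' s t j i).1 h3
      exact ⟨_, ⟨s, hs, t, ht, p, hp, rfl⟩, l, by simp, by simp⟩
    · rintro ⟨_, ⟨s, hs, t, ht, p, hp, rfl⟩, l, rfl, rfl⟩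
      have h3 := (hP' s t (l ≫ p.2.2) (l ≫ p.2.1)).2 ⟨p, hp, l, rfl, rfl⟩
      refine ⟨l ≫ p.2.1 ≫ s.2.1, (h _ _).2 ⟨s, hs, l ≫ p.2.1, by simp, by simp⟩,
        (h' _ _).2 ⟨t, ht, l ≫ p.2.2, by simpa using h3, by simp⟩⟩

end Decomposition

/-! ### Cones and countability of the rings. -/

section Cones

variable {C : Type u} [SmallCategory C]

/-- The set of paths with range `v` that extend `δ`. -/
def cone {a v : C} (δ : a ⟶ v) : Set (PathsTo v) := {μ | ∃ k : μ.1 ⟶ a, k ≫ δ = μ.2}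

theorem cone_mem_ring {a v : C} (δ : a ⟶ v) : cone δ ∈ ring v := by
  have h : (Zigzag.single δ (𝟙 v)).dom = cone δ := by
    ext μ
    simp [Zigzag.dom, Zigzag.Rel, cone, eq_comm]
  exact h ▸ dom_mem_ring _

theorem Zigzag.dom_eq_iUnion_cone {a b : C} (ζ : Zigzag a b) {D : Set (Span a b)}
    (h : ∀ {x : C} (m : x ⟶ b) (n : x ⟶ a), ζ.Rel m n ↔ ∃ s ∈ D, s.Rel m n) :
    ζ.dom = ⋃ s ∈ D, cone s.2.2 := by
  ext μ
  simp only [Zigzag.dom, Set.mem_ofPred_eq, h, Set.mem_iUnion, cone, exists_prop]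
  constructor
  · rintro ⟨n, s, hs, k, hk, -⟩
    exact ⟨s, hs, k, hk⟩
  · rintro ⟨s, hs, k, hk⟩
    exact ⟨_, s, hs, k, hk, rfl⟩

theorem isSetRing_of_isSetAlgebra {X : Type*} {A : Set (Set X)}
    (h : MeasureTheory.IsSetAlgebra A) : MeasureTheory.IsSetRing A where
  empty_mem := h.empty_mem
  union_mem := fun _ _ hs ht => h.union_mem hs ht
  sdiff_mem := fun _ _ hs ht => h.sdiff_mem hs ht

theorem countable_objects [Countable (PathSet C)] : Countable C :=
  Function.Injective.countable (f := fun v : C => (⟨v, v, 𝟙 v⟩ : PathSet C))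
    fun _ _ h => congrArg Quiver.Total.left h

theorem countable_hom [Countable (PathSet C)] (a b : C) : Countable (a ⟶ b) :=
  Function.Injective.countable (f := fun f : a ⟶ b => (⟨a, b, f⟩ : PathSet C))
    fun _ _ h => by cases h; rfl

/-- Each A(ζ) is a finite union of cones, so the ring lies in the algebra generated by the countably
many cones. -/
theorem countable_ring [CategoryOfPaths C] [Countable (PathSet C)] (hfa : FinitelyAligned C)
    (v : C) : (ring v).Countable := by
  have := countable_objects (C := C)
  have := countable_hom (C := C)
  let S : Set (Set (PathsTo v)) := Set.range fun δ : PathsTo v => cone δ.2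
  have hA := MeasureTheory.isSetAlgebra_generateSetAlgebra (𝒜 := S)
  refine (MeasureTheory.countable_generateSetAlgebra (Set.countable_range _ : S.Countable)).mono
    fun E hE => hE _ (isSetRing_of_isSetAlgebra hA) fun a ζ => ?_
  obtain ⟨D, hD, h⟩ := ζ.exists_finite_spans hfa
  rw [ζ.dom_eq_iUnion_cone h, ← hD.coe_toFinset]
  exact (isSetRing_of_isSetAlgebra hA).biUnion_mem _ fun s _ =>
    MeasureTheory.self_subset_generateSetAlgebra ⟨⟨_, s.2.2⟩, rfl⟩

end Cones

/-! ### Topology of the spaces of ultrafilters. -/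

namespace Spec

variable {C : Type u} [SmallCategory C] {v : C}

theorem exists_mem_of_biUnion_mem (x : Spec v) {ι : Type*} {D : Set ι} (hD : D.Finite)
    {f : ι → Set (PathsTo v)} (hf : ∀ i ∈ D, f i ∈ ring v) (h : ⋃ i ∈ D, f i ∈ x.sets) :
    ∃ i ∈ D, f i ∈ x.sets := by
  induction D, hD using Set.Finite.induction_on with
  | empty =>
    rw [Set.biUnion_empty] at h
    exact absurd h x.isUltrafilter.isFilter.empty_notMem
  | @insert i D _ _ ih =>
    rw [Set.biUnion_insert] at h
    have hi := hf i (Set.mem_insert _ _)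
    rcases x.mem_or_compl_mem hi with h1 | h1
    · exact ⟨i, Set.mem_insert _ _, h1⟩
    · have hU : ⋃ i ∈ D, f i ∈ x.sets := by
        refine x.superset_mem (x.inter_mem h h1) ?_ ?_
        · rw [← (‹D.Finite›).coe_toFinset]
          exact (isSetRing_ring v).biUnion_mem _ fun j hj =>
            hf j (Set.mem_insert_of_mem _ ((‹D.Finite›).mem_toFinset.1 hj))
        · rintro μ ⟨h2 | h2, h3⟩
          · exact absurd h2 h3
          · exact h2
      obtain ⟨j, hj, h2⟩ := ih (fun j hj => hf j (Set.mem_insert_of_mem _ hj)) hU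
      exact ⟨j, Set.mem_insert_of_mem _ hj, h2⟩

theorem biInter_mem (x : Spec v) {ι : Type*} {D : Set ι} (hD : D.Finite)
    {f : ι → Set (PathsTo v)} (hf : ∀ i ∈ D, f i ∈ x.sets) : ⋂ i ∈ D, f i ∈ x.sets := by
  induction D, hD using Set.Finite.induction_on with
  | empty =>
    rw [Set.biInter_empty]
    exact x.univ_mem
  | @insert i D _ _ ih =>
    rw [Set.biInter_insert]
    exact x.inter_mem (hf i (Set.mem_insert _ _)) (ih fun j hj => hf j (Set.mem_insert_of_mem _ hj))

theorem isOpen_hat {E : Set (PathsTo v)} (hE : E ∈ ring v) : IsOpen (hat E) :=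
  TopologicalSpace.isOpen_generateFrom_of_mem ⟨E, hE, rfl⟩

theorem compl_notMem (x : Spec v) {E : Set (PathsTo v)} (h : E ∈ x.sets) : Eᶜ ∉ x.sets :=
  fun h' => x.isUltrafilter.isFilter.empty_notMem (by simpa using x.inter_mem h h')

theorem isClopen_hat {E : Set (PathsTo v)} (hE : E ∈ ring v) : IsClopen (hat E) := by
  refine ⟨⟨?_⟩, isOpen_hat hE⟩
  have : (hat E)ᶜ = hat Eᶜ := by
    ext x
    exact ⟨fun h => (x.mem_or_compl_mem hE).resolve_left h, fun h h' => x.compl_notMem h' h⟩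
  exact this ▸ isOpen_hat (compl_mem_ring hE)

theorem exists_mem_notMem {x y : Spec v} (h : x ≠ y) : ∃ E ∈ x.sets, E ∉ y.sets := by
  by_contra! h'
  exact h (Spec.ext (x.isUltrafilter.maximal _ y.isUltrafilter.isFilter h').symm)

instance : TotallySeparatedSpace (Spec v) := by
  refine totallySeparatedSpace_iff_exists_isClopen.2 fun x y hxy => ?_
  obtain ⟨E, hE, hE'⟩ := exists_mem_notMem hxy
  exact ⟨hat E, isClopen_hat (x.mem_ring hE), hE, hE'⟩

/-- Stone duality: the whole of vΛ belongs to the ring, so an ultrafilter on X_v converges to the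
point whose members are the E with `hat E` in that ultrafilter. -/
instance : CompactSpace (Spec v) := by
  refine ⟨isCompact_iff_ultrafilter_le_nhds.2 fun 𝒰 _ => ?_⟩
  let z : Spec v :=
    { sets := {E | E ∈ ring v ∧ hat E ∈ 𝒰}
      isUltrafilter := by
        have hu : hat (Set.univ : Set (PathsTo v)) = Set.univ :=
          Set.eq_univ_of_forall fun x => x.univ_mem
        refine isUltrafilterIn_of ⟨fun _ h => h.1, ⟨_, univ_mem_ring v, ?_⟩, ?_, ?_, ?_⟩ ?_
        · rw [hu]
          exact Filter.univ_mem
        · rintro ⟨-, h⟩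
          obtain ⟨x, hx⟩ := 𝒰.nonempty_of_mem h
          exact x.isUltrafilter.isFilter.empty_notMem hx
        · rintro E F ⟨hE, hE'⟩ ⟨hF, hF'⟩
          exact ⟨inter_mem_ring hE hF, Filter.mem_of_superset (Filter.inter_mem hE' hF')
            fun x hx => x.inter_mem hx.1 hx.2⟩
        · rintro E F ⟨hE, hE'⟩ hF hEF
          exact ⟨hF, Filter.mem_of_superset hE' fun x hx => x.superset_mem hx hF hEF⟩
        · intro E hE
          rcases 𝒰.mem_or_compl_mem (hat E) with h | h
          · exact Or.inl ⟨hE, h⟩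
          · exact Or.inr ⟨compl_mem_ring hE, Filter.mem_of_superset h
              fun x hx => (x.mem_or_compl_mem hE).resolve_left hx⟩ }
  refine ⟨z, Set.mem_univ _, fun W hW => ?_⟩
  obtain ⟨E, hE, hEW⟩ := (mem_nhds_iff z W).1 hW
  exact Filter.mem_of_superset hE.2 hEW

theorem secondCountable [CategoryOfPaths C] [Countable (PathSet C)] (hfa : FinitelyAligned C)
    (v : C) : SecondCountableTopology (Spec v) := by
  refine ⟨_, ?_, rfl⟩
  refine ((countable_ring hfa v).image hat).mono ?_
  rintro W ⟨E, hE, rfl⟩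
  exact ⟨E, hE, rfl⟩

end Spec

/-! ### Topology of the disjoint union X. -/

namespace PathSpace

variable {C : Type u} [SmallCategory C]

theorem mem_nhds_iff {b : C} (x : Spec b) (W : Set (PathSpace C)) :
    W ∈ 𝓝 (⟨b, x⟩ : PathSpace C) ↔ ∃ E ∈ x.sets, ∀ y : Spec b, E ∈ y.sets → ⟨b, y⟩ ∈ W := by
  have h : 𝓝 (⟨b, x⟩ : PathSpace C) = Filter.map (Sigma.mk b) (𝓝 x) := Sigma.nhds_mk b x
  rw [h]
  exact Spec.mem_nhds_iff x (Sigma.mk b ⁻¹' W)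

/-- `Ê`, as a subset of `X`. -/
def hat {b : C} (E : Set (PathsTo b)) : Set (PathSpace C) :=
  (Sigma.mk b : Spec b → PathSpace C) '' Spec.hat E

theorem mk_mem_hat_iff {b : C} {E : Set (PathsTo b)} {x : Spec b} :
    (⟨b, x⟩ : PathSpace C) ∈ hat E ↔ E ∈ x.sets := by
  constructor
  · rintro ⟨y, hy, h⟩
    obtain rfl : y = x := eq_of_heq (Sigma.mk.inj h).2
    exact hy
  · exact fun h => ⟨x, h, rfl⟩

theorem eventually_nhds_iff {z : PathSpace C} {p : PathSpace C → Prop} :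
    (∀ᶠ x in 𝓝 z, p x) ↔ ∃ E ∈ z.2.sets, ∀ y ∈ (hat E : Set (PathSpace C)), p y := by
  refine (mem_nhds_iff z.2 _).trans (exists_congr fun E => and_congr_right fun _ => ?_)
  constructor
  · rintro h _ ⟨y, hy, rfl⟩
    exact h y hy
  · exact fun h y hy => h _ ⟨y, hy, rfl⟩

theorem isClopen_hat {b : C} {E : Set (PathsTo b)} (hE : E ∈ ring b) :
    IsClopen (hat E : Set (PathSpace C)) := by
  have h := Spec.isClopen_hat hE
  exact ⟨(Topology.IsClosedEmbedding.sigmaMk (σ := fun v : C => Spec v)).isClosedMap _ h.1,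
    (Topology.IsOpenEmbedding.sigmaMk (σ := fun v : C => Spec v)).isOpenMap _ h.2⟩

theorem isCompact_hat_univ (b : C) : IsCompact (hat (Set.univ : Set (PathsTo b))) := by
  have : IsCompact (Spec.hat (Set.univ : Set (PathsTo b))) :=
    (Spec.isClopen_hat (univ_mem_ring b)).1.isCompact
  exact this.image (continuous_sigmaMk (σ := fun v : C => Spec v))

instance : T2Space (PathSpace C) := inferInstanceAs (T2Space (Σ v : C, Spec v))

instance : TotallyDisconnectedSpace (PathSpace C) :=
  inferInstanceAs (TotallyDisconnectedSpace (Σ v : C, Spec v))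

instance : WeaklyLocallyCompactSpace (PathSpace C) where
  exists_compact_mem_nhds := fun ⟨b, x⟩ =>
    ⟨hat Set.univ, isCompact_hat_univ b,
      (mem_nhds_iff x _).2 ⟨Set.univ, x.univ_mem, fun _ hy => mk_mem_hat_iff.2 hy⟩⟩

theorem secondCountable [CategoryOfPaths C] [Countable (PathSet C)] (hfa : FinitelyAligned C) :
    SecondCountableTopology (PathSpace C) := by
  have := countable_objects (C := C)
  have := Spec.secondCountable hfa
  exact inferInstanceAs (SecondCountableTopology (Σ v : C, Spec v))

end PathSpace

/-! ### Longest initial segments with degree in a finite set. -/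

section Tops

variable {C : Type u} [SmallCategory C]

/-- A path with range `v`, as an element of the set of all paths. -/
def PathsTo.toPath {v : C} (μ : PathsTo v) : PathSet C := ⟨μ.1, v, μ.2⟩

theorem PathsTo.toPath_injective {v : C} :
    Function.Injective (PathsTo.toPath : PathsTo v → PathSet C) := by
  rintro ⟨a, f⟩ ⟨b, g⟩ h
  cases h
  rfl

theorem PathsTo.toPath_mem_tails {v : C} {μ α : PathsTo v} :
    μ.toPath ∈ tails α.toPath ↔ μ ∈ cone α.2 :=
  mem_tails_iff _ _

theorem PathsTo.toPath_mem_iInter {v : C} {μ : PathsTo v} {F : Set (PathsTo v)} :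
    μ.toPath ∈ ⋂ α ∈ PathsTo.toPath '' F, tails α ↔ μ ∈ ⋂ α ∈ F, cone α.2 := by
  simp only [Set.mem_iInter, Set.forall_mem_image, PathsTo.toPath_mem_tails]

theorem DegreeFunctor.deg_id {Q : Type w} [AddCommGroup Q] (ψ : DegreeFunctor C Q) (v : C) :
    ψ.deg (𝟙 v) = 0 := by
  have h := ψ.deg_mul (𝟙 v) (𝟙 v)
  rw [Category.comp_id] at h
  simpa using h

/-- The extending factor has degree zero, so it is a vertex. -/
theorem DegreeFunctor.Nondegenerate.comp_eq {Q : Type w} [AddCommGroup Q]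
    {ψ : DegreeFunctor C Q} (hnd : ψ.Nondegenerate) {a b v : C} {k : a ⟶ b}
    {e : b ⟶ v} (h : ψ.deg (k ≫ e) = ψ.deg e) :
    (⟨a, k ≫ e⟩ : PathsTo v) = ⟨b, e⟩ := by
  have hk : ψ.deg k = 0 := by
    rw [ψ.deg_mul] at h
    simpa using h
  by_contra hne
  refine hnd ⟨a, b, k⟩ (fun v h => hne ?_) hk
  cases h
  rw [Category.id_comp]

/-- A finite set of degrees that contains `0` and is closed under minimal common extensions. -/
structure DegreeFunctor.IsClosedDegreeSet {Q : Type w} [AddCommGroup Q] (ψ : DegreeFunctor C Q)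
    (T : Set Q) : Prop where
  finite : T.Finite
  zero_mem : (0 : Q) ∈ T
  image_minCommonExt : ∀ E : Set (PathSet C), E.Finite → ψ.toFun '' E ⊆ T →
    ψ.toFun '' minCommonExt E ⊆ T

/-- The vertex `v` only serves to show that 0 is a degree. -/
theorem DegreeFunctor.ExtensionFiniteness.exists_isClosedDegreeSet {Q : Type w} [AddCommGroup Q]
    {ψ : DegreeFunctor C Q} (hb : ψ.ExtensionFiniteness) (v : C) {S : Set Q} (hS : S.Finite)
    (hS' : S ⊆ Set.range ψ.toFun) : ∃ T, S ⊆ T ∧ ψ.IsClosedDegreeSet T := by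
  obtain ⟨T, h1, -, h2, h3⟩ := hb (insert 0 S) (hS.insert 0)
    (Set.insert_subset ⟨⟨v, v, 𝟙 v⟩, ψ.deg_id v⟩ hS')
  exact ⟨T, (Set.subset_insert _ _).trans h2, h1, h2 (Set.mem_insert _ _), h3⟩

/-- `e` is the longest path with degree in `T` whose tail set belongs to the ultrafilter `x`. -/
structure IsTop {Q : Type w} [AddCommGroup Q] (ψ : DegreeFunctor C Q) (T : Set Q) {v : C}
    (x : Spec v) {a : C} (e : a ⟶ v) : Prop where
  cone_mem : cone e ∈ x.sets
  deg_mem : ψ.deg e ∈ T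
  exists_factor : ∀ {b : C} (α : b ⟶ v), cone α ∈ x.sets → ψ.deg α ∈ T → ∃ k : a ⟶ b, k ≫ α = e

variable [CategoryOfPaths C] {Q : Type w} [AddCommGroup Q] {ψ : DegreeFunctor C Q}

theorem IsTop.unique {T : Set Q} {v a b : C} {x : Spec v} {e : a ⟶ v} {e' : b ⟶ v}
    (h : IsTop ψ T x e) (h' : IsTop ψ T x e') : (⟨a, e⟩ : PathsTo v) = ⟨b, e'⟩ := by
  obtain ⟨k, hk⟩ := h.exists_factor e' h'.cone_mem h'.deg_mem
  obtain ⟨l, hl⟩ := h'.exists_factor e h.cone_mem h.deg_mem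
  exact pathsTo_ext_of_factor k l hk hl

/-- The empty intersection consists of all paths, of which vertices are minimal. This rules out the
empty set as the `F` of condition (1). -/
theorem minCommonExt_empty_nonempty (v : C) : (minCommonExt (∅ : Set (PathSet C))).Nonempty := by
  refine ⟨⟨v, v, 𝟙 v⟩, by simp, fun δ _ h => ?_⟩
  obtain ⟨a, b, f⟩ := δ
  obtain rfl : v = b := right_eq_of_mem_tails h
  exact tails_antisymm h ((mem_tails_iff _ _).2 ⟨f, Category.comp_id f⟩)

/-- Finitely many cones belonging to x have nonempty intersection, so the paths have a minimal
common extension; condition (1) forbids this for every finite part of an infinite set of equal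
degree. -/
theorem finite_cone_mem_of_deg_eq (hfa : FinitelyAligned C) (ha : ψ.EqualDegreeFiniteness) {v : C}
    (x : Spec v) (t : Q) : {α : PathsTo v | cone α.2 ∈ x.sets ∧ ψ.deg α.2 = t}.Finite := by
  by_contra hinf
  obtain ⟨F, hFE, hF, hF'⟩ := ha _
    (Set.Infinite.image PathsTo.toPath_injective.injOn hinf) (by
      rintro _ ⟨α, hα, rfl⟩ _ ⟨β, hβ, rfl⟩
      exact hα.2.trans hβ.2.symm)
  obtain ⟨F, hFA, rfl⟩ := Set.subset_image_iff.1 hFE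
  replace hF := hF.of_finite_image PathsTo.toPath_injective.injOn
  rcases F.eq_empty_or_nonempty with rfl | hne
  · rw [Set.image_empty] at hF'
    exact (minCommonExt_empty_nonempty v).ne_empty hF'
  · obtain ⟨μ, hμ⟩ := x.nonempty_of_mem (x.biInter_mem hF (f := fun α => cone α.2)
      fun α hα => (hFA hα).1)
    obtain ⟨ε, hε, -⟩ := (minCommonExt_finite_and_cofinal hfa (hF.image _) (hne.image _)).2 _
      (PathsTo.toPath_mem_iInter.2 hμ)
    rw [hF'] at hε
    exact hε

/-- The set `A` of all candidates is finite. The longest path is a minimal common extension of `A`: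
condition (2) keeps its degree in `T`, and it extends every candidate by construction. -/
theorem exists_isTop (hfa : FinitelyAligned C) (ha : ψ.EqualDegreeFiniteness) {T : Set Q}
    (hT : ψ.IsClosedDegreeSet T) {v : C} (x : Spec v) : ∃ (a : C) (e : a ⟶ v), IsTop ψ T x e := by
  let A : Set (PathsTo v) := {α | cone α.2 ∈ x.sets ∧ ψ.deg α.2 ∈ T}
  have hA : A.Finite := by
    refine (hT.finite.biUnion fun t _ => finite_cone_mem_of_deg_eq hfa ha x t).subset ?_
    exact fun α hα => Set.mem_biUnion hα.2 ⟨hα.1, rfl⟩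
  have hone : (⟨v, 𝟙 v⟩ : PathsTo v) ∈ A := by
    refine ⟨x.superset_mem x.univ_mem (cone_mem_ring _) fun μ _ => ⟨μ.2, Category.comp_id _⟩, ?_⟩
    rw [ψ.deg_id]
    exact hT.zero_mem
  obtain ⟨hM, hcof⟩ := minCommonExt_finite_and_cofinal hfa (hA.image PathsTo.toPath)
    (Set.Nonempty.image _ ⟨_, hone⟩)
  have hdeg := hT.image_minCommonExt _ (hA.image PathsTo.toPath) (by
    rintro _ ⟨_, ⟨α, hα, rfl⟩, rfl⟩
    exact hα.2)
  have hM' : (PathsTo.toPath ⁻¹' minCommonExt (PathsTo.toPath '' A) : Set (PathsTo v)).Finite :=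
    hM.preimage PathsTo.toPath_injective.injOn
  -- The intersection of the cones of `A` belongs to x and is covered by the finitely many cones of
  -- minimal common extensions, so one of these belongs to x.
  obtain ⟨ε, hε, hεx⟩ := x.exists_mem_of_biUnion_mem hM' (f := fun α => cone α.2)
    (fun α _ => cone_mem_ring _) (by
      refine x.superset_mem (x.biInter_mem hA (f := fun α => cone α.2) fun α hα => hα.1) ?_ ?_
      · rw [← hM'.coe_toFinset]
        exact (isSetRing_ring v).biUnion_mem _ fun α _ => cone_mem_ring _
      · intro μ hμ
        obtain ⟨⟨a, w, f⟩, hε, h⟩ := hcof _ (PathsTo.toPath_mem_iInter.2 hμ)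
        obtain rfl : v = w := right_eq_of_mem_tails h
        exact Set.mem_biUnion (x := (⟨a, f⟩ : PathsTo v)) hε (PathsTo.toPath_mem_tails.1 h))
  refine ⟨ε.1, ε.2, hεx, hdeg ⟨_, hε, rfl⟩, fun {b} α hα hα' => ?_⟩
  have h := hε.1
  rw [PathsTo.toPath_mem_iInter] at h
  exact Set.mem_iInter₂.1 h ⟨b, α⟩ ⟨hα, hα'⟩

end Tops

/-! ### The maps δk ↦ γk and principality. -/

section Swaps

variable {C : Type u} [SmallCategory C]

/-- The zigzag whose map is `δk ↦ γk`. -/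
def Zigzag.swap {a b c : C} (γ : c ⟶ a) (δ : c ⟶ b) : Zigzag a b :=
  (Zigzag.single (𝟙 a) γ).append (Zigzag.single δ (𝟙 b))

theorem Zigzag.swap_rel {a b c x : C} (γ : c ⟶ a) (δ : c ⟶ b) (m : x ⟶ b) (n : x ⟶ a) :
    (Zigzag.swap γ δ).Rel m n ↔ ∃ k : x ⟶ c, k ≫ δ = m ∧ k ≫ γ = n := by
  simp [Zigzag.swap, Zigzag.rel_append, Zigzag.Rel, eq_comm]

theorem Zigzag.swap_dom {a b c : C} (γ : c ⟶ a) (δ : c ⟶ b) :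
    (Zigzag.swap γ δ).dom = cone δ := by
  ext μ
  simp only [Zigzag.dom, Zigzag.swap_rel, cone, Set.mem_ofPred_eq]
  exact ⟨fun ⟨_, k, h, _⟩ => ⟨k, h⟩, fun ⟨k, h⟩ => ⟨_, k, h, rfl⟩⟩

theorem Zigzag.swap_degree {Q : Type w} [AddCommGroup Q] (ψ : DegreeFunctor C Q) {a b c : C}
    (γ : c ⟶ a) (δ : c ⟶ b) : (Zigzag.swap γ δ).degree ψ = ψ.deg γ - ψ.deg δ := by
  simp [Zigzag.swap, Zigzag.degree_append, Zigzag.degree, ψ.deg_id, sub_eq_add_neg]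

variable [CategoryOfPaths C]

theorem Spec.cone_mem_map_swap {a b c d : C} (γ : c ⟶ a) (δ : c ⟶ b) (η : d ⟶ c) (x : Spec b)
    (h : (Zigzag.swap γ δ).dom ∈ x.sets) :
    cone (η ≫ γ) ∈ (Spec.map (Zigzag.swap γ δ) x h).sets ↔ cone (η ≫ δ) ∈ x.sets := by
  have e : (Zigzag.swap γ δ).preimage (cone (η ≫ γ)) = cone (η ≫ δ) := by
    ext ⟨z, m⟩
    simp only [Zigzag.preimage, Zigzag.swap_rel, cone, Set.mem_ofPred_eq]
    constructor
    · rintro ⟨_, ⟨k, rfl, rfl⟩, l, hl⟩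
      refine ⟨l, ?_⟩
      rw [← Category.assoc] at hl ⊢
      rw [CategoryOfPaths.left_cancel γ _ _ hl]
    · rintro ⟨k, rfl⟩
      exact ⟨k ≫ η ≫ γ, ⟨k ≫ η, Category.assoc _ _ _, Category.assoc _ _ _⟩, k, rfl⟩
  constructor
  · rintro ⟨-, h⟩
    exact e ▸ h
  · exact fun h => ⟨cone_mem_ring _, e.symm ▸ h⟩

/-- Near a point of its domain, a zigzag map is of the form `δk ↦ γk`. -/
theorem Spec.exists_swap (hfa : FinitelyAligned C) {a b : C} (ζ : Zigzag a b) (x : Spec b)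
    (h : ζ.dom ∈ x.sets) : ∃ (c : C) (γ : c ⟶ a) (δ : c ⟶ b), cone δ ∈ x.sets ∧
      (∀ {z : C} (k : z ⟶ c), ζ.Rel (k ≫ δ) (k ≫ γ)) ∧
      ∀ μ ∈ cone δ, ∀ n, ζ.Rel μ.2 n ↔ (Zigzag.swap γ δ).Rel μ.2 n := by
  obtain ⟨D, hD, hζ⟩ := ζ.exists_finite_spans hfa
  rw [ζ.dom_eq_iUnion_cone hζ] at h
  obtain ⟨s, hs, hsx⟩ := x.exists_mem_of_biUnion_mem hD (fun s _ => cone_mem_ring _) h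
  have key : ∀ {z : C} (k : z ⟶ s.1), ζ.Rel (k ≫ s.2.2) (k ≫ s.2.1) :=
    fun k => (hζ _ _).2 ⟨s, hs, k, rfl, rfl⟩
  refine ⟨s.1, s.2.1, s.2.2, hsx, key, ?_⟩
  rintro ⟨z, m⟩ hm n
  obtain ⟨k, rfl⟩ : ∃ k : z ⟶ s.1, k ≫ s.2.2 = m := hm
  rw [Zigzag.swap_rel]
  constructor
  · exact fun h => ⟨k, rfl, ζ.rel_unique (key k) h⟩
  · rintro ⟨l, hl, rfl⟩
    rw [CategoryOfPaths.left_cancel _ _ _ hl]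
    exact key k

variable {Q : Type w} [AddCommGroup Q] {ψ : DegreeFunctor C Q}

/-- The swap matches cones inside `cone δ` with cones inside `cone γ` and preserves degrees. Both
longest paths extend δ, respectively γ, because that degree lies in `T`; so they correspond to each
other. -/
theorem IsTop.map_swap (hfa : FinitelyAligned C) (ha : ψ.EqualDegreeFiniteness) {T : Set Q}
    (hT : ψ.IsClosedDegreeSet T) {a b c d : C} {γ : c ⟶ a} {δ : c ⟶ b} (hγ : ψ.deg γ ∈ T)
    (hδ : ψ.deg δ = ψ.deg γ) {x : Spec b} (h : (Zigzag.swap γ δ).dom ∈ x.sets) {e : d ⟶ b}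
    (he : IsTop ψ T x e) :
    ∃ η : d ⟶ c, η ≫ δ = e ∧ IsTop ψ T (Spec.map (Zigzag.swap γ δ) x h) (η ≫ γ) := by
  have hdeg : ∀ {z : C} (k : z ⟶ c), ψ.deg (k ≫ δ) = ψ.deg (k ≫ γ) := fun k => by
    rw [ψ.deg_mul, ψ.deg_mul, hδ]
  have hδx : cone δ ∈ x.sets := Zigzag.swap_dom γ δ ▸ h
  obtain ⟨η, rfl⟩ := he.exists_factor δ hδx (hδ ▸ hγ)
  refine ⟨η, rfl, ?_⟩
  obtain ⟨d', e', he'⟩ := exists_isTop hfa ha hT (Spec.map (Zigzag.swap γ δ) x h)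
  have hγx : cone γ ∈ (Spec.map (Zigzag.swap γ δ) x h).sets := by
    have := (Spec.cone_mem_map_swap γ δ (𝟙 c) x h).2 (by rwa [Category.id_comp])
    rwa [Category.id_comp] at this
  obtain ⟨η', rfl⟩ := he'.exists_factor γ hγx hγ
  -- The longest path at the image, moved back, is a candidate at `x`, and the longest path at `x`,
  -- moved forward, is a candidate at the image. Hence η and η' extend each other.
  obtain ⟨k, hk⟩ := he.exists_factor (η' ≫ δ)
    ((Spec.cone_mem_map_swap γ δ η' x h).1 he'.cone_mem) (hdeg η' ▸ he'.deg_mem)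
  obtain ⟨l, hl⟩ := he'.exists_factor (η ≫ γ)
    ((Spec.cone_mem_map_swap γ δ η x h).2 he.cone_mem) (hdeg η ▸ he.deg_mem)
  rw [← Category.assoc] at hk hl
  cases pathsTo_ext_of_factor l k (CategoryOfPaths.left_cancel _ _ _ hl)
    (CategoryOfPaths.left_cancel _ _ _ hk)
  exact he'

/-- A germ of degree zero with equal source and range is a unit. -/
theorem Spec.agreeNear_unit (hfa : FinitelyAligned C) (ha : ψ.EqualDegreeFiniteness)
    (hb : ψ.ExtensionFiniteness) {v : C} {ζ : Zigzag v v} (hζ : ζ.degree ψ = 0) {x : Spec v}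
    (h : ζ.dom ∈ x.sets) (hx : Spec.map ζ x h = x) :
    Spec.AgreeNear x ζ (Zigzag.single (𝟙 v) (𝟙 v)) := by
  obtain ⟨c, γ, δ, hδx, hrel, heq⟩ := Spec.exists_swap hfa ζ x h
  have hdeg : ψ.deg δ = ψ.deg γ := by
    have := Zigzag.degree_of_rel ψ ζ (hrel (𝟙 c))
    rw [hζ, Category.id_comp, Category.id_comp] at this
    exact (sub_eq_zero.1 this.symm).symm
  obtain ⟨T, hST, hT⟩ := hb.exists_isClosedDegreeSet v (Set.finite_singleton (ψ.deg γ))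
    (Set.singleton_subset_iff.2 ⟨⟨c, v, γ⟩, rfl⟩)
  have hsw : (Zigzag.swap γ δ).dom ∈ x.sets := Zigzag.swap_dom γ δ ▸ hδx
  have hmap := Spec.map_eq_of_rel_iff ζ (Zigzag.swap γ δ) x h hsw _ hδx heq
  obtain ⟨d, e, he⟩ := exists_isTop hfa ha hT x
  obtain ⟨η, rfl, he'⟩ := he.map_swap hfa ha hT (hST rfl) hdeg hsw
  rw [← hmap, hx] at he'
  -- Both are the longest path at the fixed point `x`; right cancellation then gives γ = δ, and the
  -- zigzag is the identity on that cone.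
  have h1 : η ≫ γ = η ≫ δ := eq_of_heq (Sigma.mk.inj (he'.unique he)).2
  obtain rfl := CategoryOfPaths.right_cancel _ _ _ h1
  have hu : (Zigzag.single (𝟙 v) (𝟙 v)).dom = Set.univ :=
    Set.eq_univ_of_forall fun μ => ⟨μ.2, rfl⟩
  refine Spec.agreeNear_of_rel_iff _ _ x h (hu ▸ x.univ_mem) _ hδx fun μ hμ n => ?_
  rw [heq μ hμ, Zigzag.swap_rel]
  obtain ⟨z, m⟩ := μ
  obtain ⟨k, rfl⟩ : ∃ k : z ⟶ c, k ≫ γ = m := hμ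
  simp only [Zigzag.Rel, Category.comp_id]
  constructor
  · rintro ⟨l, hl, rfl⟩
    exact hl.symm
  · exact fun h => ⟨k, rfl, h⟩

end Swaps

/-! ### The partial action of zigzags on X. -/

section Action

variable {C : Type u} [SmallCategory C] [CategoryOfPaths C]

/-- `Φ_ζ(x)` is defined and equals `y`. -/
def Act {a b : C} (ζ : Zigzag a b) (x y : PathSpace C) : Prop :=
  ∃ (x' : Spec b) (h : ζ.dom ∈ x'.sets), x = ⟨b, x'⟩ ∧ y = ⟨a, Spec.map ζ x' h⟩

namespace Act

variable {a b c : C} {ζ : Zigzag a b} {x y z : PathSpace C}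

theorem mk (ζ : Zigzag a b) (x : Spec b) (h : ζ.dom ∈ x.sets) :
    Act ζ ⟨b, x⟩ ⟨a, Spec.map ζ x h⟩ := ⟨x, h, rfl, rfl⟩

theorem source_eq (h : Act ζ x y) : x.1 = b := by
  obtain ⟨x, h, rfl, rfl⟩ := h
  rfl

theorem range_eq (h : Act ζ x y) : y.1 = a := by
  obtain ⟨x, h, rfl, rfl⟩ := h
  rfl

theorem dom_mem {x : Spec b} (h : Act ζ ⟨b, x⟩ y) :
    ∃ h : ζ.dom ∈ x.sets, y = ⟨a, Spec.map ζ x h⟩ := by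
  obtain ⟨x', h, hx, rfl⟩ := h
  obtain rfl : x = x' := eq_of_heq (Sigma.mk.inj hx).2
  exact ⟨h, rfl⟩

theorem unique (h : Act ζ x y) (h' : Act ζ x z) : y = z := by
  obtain ⟨x, h, rfl, rfl⟩ := h
  exact h'.dom_mem.2.symm

theorem reverse (h : Act ζ x y) : Act ζ.reverse y x := by
  obtain ⟨x, h, rfl, rfl⟩ := h
  exact ⟨_, Spec.dom_reverse_mem ζ x h, rfl, by rw [Spec.map_reverse]⟩

theorem congr_on {ζ ξ : Zigzag a b} {x : Spec b} {E : Set (PathsTo b)} (hE : E ∈ x.sets)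
    (hr : ∀ μ ∈ E, ∀ n, ζ.Rel μ.2 n ↔ ξ.Rel μ.2 n) (h : Act ζ ⟨b, x⟩ y) : Act ξ ⟨b, x⟩ y := by
  obtain ⟨hx, rfl⟩ := h.dom_mem
  have h' : ξ.dom ∈ x.sets := x.superset_mem (x.inter_mem hx hE) (dom_mem_ring _)
    fun μ ⟨⟨n, hn⟩, hμ⟩ => ⟨n, (hr μ hμ n).1 hn⟩
  exact ⟨x, h', rfl, by rw [Spec.map_eq_of_rel_iff ζ ξ x hx h' E hE hr]⟩

theorem congr {ζ ξ : Zigzag a b}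
    (hr : ∀ {z : C} (m : z ⟶ b) (n : z ⟶ a), ζ.Rel m n ↔ ξ.Rel m n) (h : Act ζ x y) :
    Act ξ x y := by
  obtain ⟨x, hx, rfl, rfl⟩ := h
  exact (mk ζ x hx).congr_on x.univ_mem fun μ _ n => hr _ _

theorem of_reverse (h : Act ζ.reverse y x) : Act ζ x y :=
  h.reverse.congr fun _ _ => by rw [Zigzag.rel_reverse, Zigzag.rel_reverse]

theorem injective (h : Act ζ x z) (h' : Act ζ y z) : x = y := h.reverse.unique h'.reverse

theorem append {ξ : Zigzag b c} (h : Act ξ x y) (h' : Act ζ y z) : Act (ζ.append ξ) x z := by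
  obtain ⟨x, h, rfl, rfl⟩ := h
  obtain ⟨hy, rfl⟩ := h'.dom_mem
  exact ⟨x, Spec.dom_append_mem ζ ξ x h hy, rfl, by rw [Spec.map_append]⟩

theorem of_append {ξ : Zigzag b c} (h : Act (ζ.append ξ) x z) : ∃ y, Act ξ x y ∧ Act ζ y z := by
  obtain ⟨x, h, rfl, rfl⟩ := h
  have h1 : ξ.dom ∈ x.sets := x.superset_mem h (dom_mem_ring _) fun μ ⟨n, hn⟩ => by
    obtain ⟨k, hk, -⟩ := (Zigzag.rel_append _ _ _ _).1 hn
    exact ⟨k, hk⟩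
  have h2 : ζ.dom ∈ (Spec.map ξ x h1).sets := by
    refine ⟨dom_mem_ring _, x.superset_mem h (preimage_mem_ring _ (dom_mem_ring _)) ?_⟩
    rintro μ ⟨n, hn⟩
    obtain ⟨k, hk, hk'⟩ := (Zigzag.rel_append _ _ _ _).1 hn
    exact ⟨k, hk, n, hk'⟩
  exact ⟨_, mk ξ x h1, _, h2, rfl, by rw [Spec.map_append]⟩

theorem unit (x : PathSpace C) : Act (Zigzag.single (𝟙 x.1) (𝟙 x.1)) x x := by
  obtain ⟨h, e⟩ := (ZigzagFromTo.unit x).2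
  obtain ⟨v, x⟩ := x
  exact ⟨x, h, rfl, congrArg (Sigma.mk v) e.symm⟩

/-- Continuity of Φ_ζ together with openness of its domain. -/
theorem eventually (h : Act ζ x y) {U : Set (PathSpace C)} (hU : U ∈ 𝓝 y) :
    ∀ᶠ x' in 𝓝 x, ∃ y' ∈ U, Act ζ x' y' := by
  obtain ⟨x, h, rfl, rfl⟩ := h
  obtain ⟨E, hE, hEU⟩ := (PathSpace.mem_nhds_iff _ _).1 hU
  refine (PathSpace.mem_nhds_iff _ _).2 ⟨_, hE.2, fun x' hx' => ?_⟩
  have hd : ζ.dom ∈ x'.sets := x'.superset_mem hx' (dom_mem_ring _) fun μ ⟨n, hn, _⟩ => ⟨n, hn⟩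
  exact ⟨_, hEU (Spec.map ζ x' hd) ⟨hE.1, hx'⟩, mk ζ x' hd⟩

/-- The domain of Φ_ζ is also closed, so being undefined is an open condition. -/
theorem eventually_not (h : ¬ ∃ y, Act ζ x y) : ∀ᶠ x' in 𝓝 x, ¬ ∃ y, Act ζ x' y := by
  have hc : IsClosed {x : PathSpace C | ∃ y, Act ζ x y} := by
    have : {x : PathSpace C | ∃ y, Act ζ x y} = PathSpace.hat ζ.dom := by
      ext x
      constructor
      · rintro ⟨y, x, h, rfl, -⟩
        exact PathSpace.mk_mem_hat_iff.2 h
      · rintro ⟨x, h, rfl⟩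
        exact ⟨_, mk ζ x h⟩
    exact this ▸ (PathSpace.isClopen_hat (dom_mem_ring ζ)).1
  exact hc.isOpen_compl.mem_nhds h

theorem isClopen_preimage (ζ : Zigzag a b) {U : Set (PathSpace C)} (hU : IsClopen U) :
    IsClopen {x : PathSpace C | ∃ y ∈ U, Act ζ x y} := by
  refine ⟨isOpen_compl_iff.1 (isOpen_iff_mem_nhds.2 fun x hx => ?_),
    isOpen_iff_mem_nhds.2 fun x hx => ?_⟩
  · by_cases h : ∃ y, Act ζ x y
    · obtain ⟨y, hy⟩ := h
      have hyU : Uᶜ ∈ 𝓝 y := hU.1.isOpen_compl.mem_nhds fun h => hx ⟨y, h, hy⟩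
      filter_upwards [hy.eventually hyU] with x' ⟨y', hy', h'⟩
      rintro ⟨y'', hy'', h''⟩
      exact hy' (h'.unique h'' ▸ hy'')
    · filter_upwards [eventually_not h] with x' hx'
      exact fun ⟨y', _, h'⟩ => hx' ⟨y', h'⟩
  · obtain ⟨y, hy, h⟩ := hx
    exact h.eventually (hU.2.mem_nhds hy)

theorem swap_self {d v : C} (e : d ⟶ v) (x : Spec v) (h : cone e ∈ x.sets) :
    Act (Zigzag.swap e e) ⟨v, x⟩ ⟨v, x⟩ := by
  refine (unit (⟨v, x⟩ : PathSpace C)).congr_on h ?_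
  rintro ⟨z, m⟩ hm n
  obtain ⟨k, rfl⟩ : ∃ k : z ⟶ d, k ≫ e = m := hm
  simp only [Zigzag.Rel, Zigzag.swap_rel, Category.comp_id]
  constructor
  · exact fun h => ⟨k, rfl, h⟩
  · rintro ⟨l, hl, rfl⟩
    exact hl.symm

theorem swap_symm {d : C} {f : d ⟶ a} {e : d ⟶ b} (h : Act (Zigzag.swap f e) x y) :
    Act (Zigzag.swap e f) y x :=
  h.reverse.congr fun m n => by
    simp only [Zigzag.rel_reverse, Zigzag.swap_rel, and_comm]

theorem swap_trans {d : C} {g : d ⟶ a} {f : d ⟶ b} {e : d ⟶ c} (h : Act (Zigzag.swap f e) x y)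
    (h' : Act (Zigzag.swap g f) y z) : Act (Zigzag.swap g e) x z :=
  (h.append h').congr fun m n => by
    simp only [Zigzag.rel_append, Zigzag.swap_rel]
    constructor
    · rintro ⟨_, ⟨k, rfl, rfl⟩, l, hl, rfl⟩
      obtain rfl := CategoryOfPaths.left_cancel _ _ _ hl
      exact ⟨_, rfl, rfl⟩
    · rintro ⟨k, rfl, rfl⟩
      exact ⟨_, ⟨k, rfl, rfl⟩, k, rfl, rfl⟩

/-- Lengthening both legs by η restricts the map δk ↦ γk to the smaller cone without changing its
values there. -/
theorem swap_comp {d : C} {γ : c ⟶ a} {δ : c ⟶ b} (η : d ⟶ c) {x : Spec b}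
    (hη : cone (η ≫ δ) ∈ x.sets) (h : Act (Zigzag.swap γ δ) ⟨b, x⟩ y) :
    Act (Zigzag.swap (η ≫ γ) (η ≫ δ)) ⟨b, x⟩ y := by
  refine h.congr_on hη ?_
  rintro ⟨z, m⟩ hm n
  obtain ⟨k, rfl⟩ : ∃ k : z ⟶ d, k ≫ η ≫ δ = m := hm
  simp only [Zigzag.swap_rel]
  constructor
  · rintro ⟨l, hl, rfl⟩
    rw [← Category.assoc] at hl
    obtain rfl := CategoryOfPaths.left_cancel _ _ _ hl
    exact ⟨k, rfl, (Category.assoc _ _ _).symm⟩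
  · rintro ⟨l, hl, rfl⟩
    exact ⟨l ≫ η, by rw [Category.assoc, hl], Category.assoc _ _ _⟩

variable {Q : Type w} [AddCommGroup Q] {ψ : DegreeFunctor C Q}

theorem eventually_self (hfa : FinitelyAligned C) (ha : ψ.EqualDegreeFiniteness)
    (hb : ψ.ExtensionFiniteness) (hζ : ζ.degree ψ = 0) (h : Act ζ x x) :
    ∀ᶠ x' in 𝓝 x, Act ζ x' x' := by
  obtain ⟨x, hx, rfl, e⟩ := h
  obtain rfl : b = a := (Sigma.mk.inj e).1
  replace e : x = Spec.map ζ x hx := eq_of_heq (Sigma.mk.inj e).2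
  obtain ⟨U, hU, h⟩ := Spec.agreeNear_unit hfa ha hb hζ hx e.symm
  obtain ⟨E, hE, hEU⟩ := (Spec.mem_nhds_iff _ _).1 hU
  refine (PathSpace.mem_nhds_iff _ _).2 ⟨E, hE, fun y hy => ?_⟩
  obtain ⟨h1, h2, h3⟩ := h y (hEU hy)
  exact ⟨y, h1, rfl, by rw [h3]; exact (unit (⟨b, y⟩ : PathSpace C)).dom_mem.2⟩

/-- Two zigzags of degree zero that move `x` to the same point agree near `x`. -/
theorem eventually_eq (hfa : FinitelyAligned C) (ha : ψ.EqualDegreeFiniteness)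
    (hb : ψ.ExtensionFiniteness) (hζ : ζ.degree ψ = 0) {a' b' : C} {ξ : Zigzag a' b'}
    (hξ : ξ.degree ψ = 0) (h : Act ζ x y) (h' : Act ξ x y) :
    ∀ᶠ x' in 𝓝 x, ∃ y', Act ζ x' y' ∧ Act ξ x' y' := by
  obtain rfl := h.source_eq.symm.trans h'.source_eq
  obtain rfl := h.range_eq.symm.trans h'.range_eq
  have hd : (ξ.reverse.append ζ).degree ψ = 0 := by
    rw [Zigzag.degree_append, Zigzag.degree_reverse, hζ, hξ, neg_zero, add_zero]
  filter_upwards [(h.append h'.reverse).eventually_self hfa ha hb hd] with x' hx'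
  obtain ⟨y', h1, h2⟩ := hx'.of_append
  exact ⟨y', h1, h2.of_reverse⟩

end Act

end Action

/-! ### Orbit relations of finite sets of spans, and towers. -/

section Orbits

variable {C : Type u} [SmallCategory C] {Q : Type w} [AddCommGroup Q] {ψ : DegreeFunctor C Q}

/-- The zigzag `δk ↦ γk` of a span `(γ, δ)`. -/
def spanZigzag (p : Σ a b : C, Span a b) : Zigzag p.1 p.2.1 :=
  Zigzag.swap p.2.2.2.1 p.2.2.2.2

/-- A set of spans consisting of pairs of paths of equal degree. -/
def EqualDegrees (ψ : DegreeFunctor C Q) (S : Set (Σ a b : C, Span a b)) : Prop :=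
  ∀ p ∈ S, ψ.deg p.2.2.2.2 = ψ.deg p.2.2.2.1

theorem EqualDegrees.degree_eq_zero {S : Set (Σ a b : C, Span a b)} (hS : EqualDegrees ψ S)
    {p : Σ a b : C, Span a b} (hp : p ∈ S) : (spanZigzag p).degree ψ = 0 := by
  rw [spanZigzag, Zigzag.swap_degree, hS p hp, sub_self]

variable [CategoryOfPaths C]

/-- The orbit equivalence relation of the partial homeomorphisms `Φ` of a set of spans. -/
def OrbitRel (S : Set (Σ a b : C, Span a b)) : PathSpace C → PathSpace C → Prop :=
  Relation.EqvGen fun x y => ∃ p ∈ S, Act (spanZigzag p) x y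

theorem OrbitRel.equivalence (S : Set (Σ a b : C, Span a b)) : Equivalence (OrbitRel S) :=
  Relation.EqvGen.is_equivalence _

theorem OrbitRel.mono {S S' : Set (Σ a b : C, Span a b)} (h : S ⊆ S') {x y : PathSpace C}
    (hxy : OrbitRel S x y) : OrbitRel S' x y :=
  Relation.EqvGen.mono (fun _ _ h' => h'.imp fun _ h' => ⟨h h'.1, h'.2⟩) x y hxy

/-- A chain of generators and their inverses concatenates to a single zigzag of degree zero. It
stays inside orbits wherever it is defined, so the relation spreads to neighbouring points. -/
theorem OrbitRel.exists_zigzag {S : Set (Σ a b : C, Span a b)} (hS : EqualDegrees ψ S)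
    {x y : PathSpace C} (h : OrbitRel S x y) :
    ∃ ζ : Zigzag y.1 x.1, ζ.degree ψ = 0 ∧ Act ζ x y ∧
      ∀ x' y', Act ζ x' y' → OrbitRel S x' y' := by
  induction h with
  | rel x y h =>
    obtain ⟨p, hp, h⟩ := h
    have h1 : ∀ x' y', Act (spanZigzag p) x' y' → OrbitRel S x' y' :=
      fun x' y' h' => Relation.EqvGen.rel _ _ ⟨p, hp, h'⟩
    have h2 := hS.degree_eq_zero hp
    obtain ⟨x, hx, rfl, rfl⟩ := h
    exact ⟨spanZigzag p, h2, Act.mk _ x hx, h1⟩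
  | refl x =>
    refine ⟨Zigzag.single (𝟙 x.1) (𝟙 x.1), sub_self _, Act.unit x, fun x' y' h => ?_⟩
    obtain ⟨v, x⟩ := x
    obtain rfl := h.source_eq
    rw [h.unique (Act.unit x')]
    exact Relation.EqvGen.refl _
  | symm x y _ ih =>
    obtain ⟨ζ, h1, h2, h3⟩ := ih
    refine ⟨ζ.reverse, by rw [Zigzag.degree_reverse, h1, neg_zero], h2.reverse, fun x' y' h => ?_⟩
    exact Relation.EqvGen.symm _ _ (h3 _ _ h.of_reverse)
  | trans x y z _ _ ih ih' =>
    obtain ⟨ζ, h1, h2, h3⟩ := ih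
    obtain ⟨ξ, h1', h2', h3'⟩ := ih'
    refine ⟨ξ.append ζ, by rw [Zigzag.degree_append, h1, h1', zero_add], h2.append h2',
      fun x' y' h => ?_⟩
    obtain ⟨k, hk, hk'⟩ := h.of_append
    exact Relation.EqvGen.trans _ _ _ (h3 _ _ hk) (h3' _ _ hk')

/-- A clopen set of representatives together with finitely many partial homeomorphisms, defined by
zigzags of degree zero, that sweep out the `R`-classes of its points. -/
structure Tower (ψ : DegreeFunctor C Q) (R : PathSpace C → PathSpace C → Prop) where
  base : Set (PathSpace C)
  isClopen_base : IsClopen base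
  height : ℕ
  map : Fin height → PathSpace C → PathSpace C
  exists_zigzag : ∀ j, ∃ (a b : C) (ζ : Zigzag a b), ζ.degree ψ = 0 ∧ ∀ y ∈ base, Act ζ y (map j y)
  rel : ∀ j, ∀ y ∈ base, R y (map j y)
  exists_eq : ∀ y ∈ base, ∀ y', R y y' → ∃ j, y' = map j y
  injective : ∀ j j', ∀ y ∈ base, ∀ y' ∈ base, map j y = map j' y' → j = j' ∧ y = y'

/-- If ξ is defined at q, the composite ξζ and some `η k` have degree zero and move z to the same
point, so they agree near z by principality. If ξ is undefined at q, it is undefined near q and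
nothing is to be shown. -/
theorem eventually_act_of_orbit (hfa : FinitelyAligned C) (ha : ψ.EqualDegreeFiniteness)
    (hb : ψ.ExtensionFiniteness) {z q : PathSpace C} {a b c d : C} {ζ : Zigzag c d}
    (hζ : ζ.degree ψ = 0) (hzq : Act ζ z q) {ξ : Zigzag a b} (hξ : ξ.degree ψ = 0) {ι : Type*}
    {cod dom : ι → C} {η : ∀ k, Zigzag (cod k) (dom k)} (hη : ∀ k, (η k).degree ψ = 0)
    (h : ∀ w, Act ξ q w → ∃ k, Act (η k) z w) :
    ∀ᶠ x in 𝓝 z, ∀ y y', Act ζ x y → Act ξ y y' → ∃ k, Act (η k) x y' := by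
  by_cases hw : ∃ w, Act ξ q w
  · obtain ⟨w, hw⟩ := hw
    obtain ⟨k, hk⟩ := h w hw
    obtain rfl := hzq.range_eq.symm.trans hw.source_eq
    have hd : (ξ.append ζ).degree ψ = 0 := by rw [Zigzag.degree_append, hζ, hξ, zero_add]
    filter_upwards [(hzq.append hw).eventually_eq hfa ha hb hd (hη k) hk] with x ⟨y'', h1, h2⟩
    intro y y' hy hy'
    exact ⟨k, h1.unique (hy.append hy') ▸ h2⟩
  · filter_upwards [hzq.eventually (Act.eventually_not hw)] with x ⟨y₁, h1, h2⟩
    intro y y' hy hy'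
    exact absurd ⟨y', h2.unique hy ▸ hy'⟩ h1

/-- Near z the orbit looks like that of z: the zigzags reaching the points of the orbit of z have
disjoint images, and together these are closed under the generators and their inverses. -/
theorem exists_tower (hfa : FinitelyAligned C) (ha : ψ.EqualDegreeFiniteness)
    (hb : ψ.ExtensionFiniteness) {S : Set (Σ a b : C, Span a b)} (hSf : S.Finite)
    (hS : EqualDegrees ψ S) (z : PathSpace C) (hO : {y | OrbitRel S z y}.Finite) :
    ∃ t : Tower ψ (OrbitRel S), z ∈ t.base := by
  have hne : Nonempty (PathSpace C) := ⟨z⟩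
  have heqv := OrbitRel.equivalence S
  have := hO.to_subtype
  obtain ⟨n, ⟨e⟩⟩ := Finite.exists_equiv_fin {y | OrbitRel S z y}
  let pt : Fin n → PathSpace C := fun j => (e.symm j).1
  have hpt : ∀ j, OrbitRel S z (pt j) := fun j => (e.symm j).2
  have hsurj : ∀ y, OrbitRel S z y → ∃ j, y = pt j := fun y hy => ⟨e ⟨y, hy⟩, by simp [pt]⟩
  choose ζ hζ hζz hζR using fun j => (hpt j).exists_zigzag hS
  -- Disjoint neighbourhoods of the orbit points keep the levels of the tower apart.
  obtain ⟨U, hU, hdisj⟩ := hO.t2_separation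
  have hA : ∀ᶠ x in 𝓝 z, ∀ j, ∃ y ∈ U (pt j), Act (ζ j) x y :=
    Filter.eventually_all.2 fun j =>
      (hζz j).eventually ((hU (pt j)).2.mem_nhds (hU (pt j)).1)
  have hact : ∀ w, OrbitRel S z w → ∃ k, Act (ζ k) z w := fun w hw => by
    obtain ⟨k, rfl⟩ := hsurj w hw
    exact ⟨k, hζz k⟩
  have hB : ∀ᶠ x in 𝓝 z, ∀ p ∈ S, ∀ j y y', Act (ζ j) x y → Act (spanZigzag p) y y' →
      ∃ k, Act (ζ k) x y' :=
    (Filter.eventually_all_finite hSf).2 fun p hp => Filter.eventually_all.2 fun j =>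
      eventually_act_of_orbit hfa ha hb (hζ j) (hζz j) (hS.degree_eq_zero hp) hζ fun w hw =>
        hact w (heqv.trans (hpt j) (Relation.EqvGen.rel _ _ ⟨p, hp, hw⟩))
  have hB' : ∀ᶠ x in 𝓝 z, ∀ p ∈ S, ∀ j y y', Act (ζ j) x y → Act (spanZigzag p).reverse y y' →
      ∃ k, Act (ζ k) x y' :=
    (Filter.eventually_all_finite hSf).2 fun p hp => Filter.eventually_all.2 fun j =>
      eventually_act_of_orbit hfa ha hb (hζ j) (hζz j)
        (by rw [Zigzag.degree_reverse, hS.degree_eq_zero hp, neg_zero]) hζ fun w hw =>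
        hact w (heqv.trans (hpt j)
          (heqv.symm (Relation.EqvGen.rel _ _ ⟨p, hp, hw.of_reverse⟩)))
  obtain ⟨j₀, hj₀⟩ := hsurj z (heqv.refl z)
  -- The level over z itself is the identity nearby, so every base point is one of its own
  -- translates.
  have hC : ∀ᶠ x in 𝓝 z, Act (ζ j₀) x x := by
    have h : Act (ζ j₀) z z := by
      have h' : ∀ q, q = z → Act (ζ j₀) z q → Act (ζ j₀) z z := fun q hq h => hq ▸ h
      exact h' _ hj₀.symm (hζz j₀)
    exact h.eventually_self hfa ha hb (hζ j₀)
  obtain ⟨E, hE, hN⟩ := PathSpace.eventually_nhds_iff.1 (hA.and (hB.and (hB'.and hC)))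
  -- The level maps are made total by `Classical.epsilon`; their values matter only on the base.
  have hmap : ∀ j, ∀ y ∈ (PathSpace.hat E : Set (PathSpace C)),
      Act (ζ j) y (Classical.epsilon fun y' => Act (ζ j) y y') := fun j y hy => by
    obtain ⟨y', -, h⟩ := (hN y hy).1 j
    exact Classical.epsilon_spec (p := fun y' => Act (ζ j) y y') ⟨y', h⟩
  refine ⟨{
    base := PathSpace.hat E
    isClopen_base := PathSpace.isClopen_hat (z.2.mem_ring hE)
    height := n
    map := fun j y => Classical.epsilon fun y' => Act (ζ j) y y'
    exists_zigzag := fun j => ⟨_, _, ζ j, hζ j, hmap j⟩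
    rel := fun j y hy => hζR j _ _ (hmap j y hy)
    exists_eq := ?_
    injective := ?_ }, PathSpace.mk_mem_hat_iff.2 hE⟩
  · intro y hy y' hyy'
    obtain ⟨-, h1, h2, h3⟩ := hN y hy
    -- Being a translate of `y` is invariant under generators in both directions, hence under the
    -- relation they generate.
    have key : ∀ p q, OrbitRel S p q → ((∃ k, Act (ζ k) y p) ↔ ∃ k, Act (ζ k) y q) := by
      intro p q hpq
      induction hpq with
      | rel p q h =>
        obtain ⟨s, hs, h⟩ := h
        exact ⟨fun ⟨k, hk⟩ => h1 s hs k p q hk h, fun ⟨k, hk⟩ => h2 s hs k q p hk h.reverse⟩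
      | refl p => exact Iff.rfl
      | symm p q _ ih => exact ih.symm
      | trans p q r _ _ ih ih' => exact ih.trans ih'
    obtain ⟨k, hk⟩ := (key y y' hyy').1 ⟨j₀, h3⟩
    exact ⟨k, hk.unique (hmap k y hy)⟩
  · intro j j' y hy y' hy' heq
    have hmem : ∀ i, ∀ x ∈ (PathSpace.hat E : Set (PathSpace C)),
        (Classical.epsilon fun x' => Act (ζ i) x x') ∈ U (pt i) := fun i x hx => by
      obtain ⟨x', hx', h⟩ := (hN x hx).1 i
      exact h.unique (hmap i x hx) ▸ hx'
    have hpteq : pt j = pt j' := by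
      by_contra hne
      exact Set.disjoint_left.1 (hdisj (hpt j) (hpt j') hne) (hmem j y hy)
        (by rw [heq]; exact hmem j' y' hy')
    obtain rfl : j = j' := e.symm.injective (Subtype.ext hpteq)
    refine ⟨rfl, (hmap j y hy).injective ?_⟩
    rw [heq]
    exact hmap j y' hy'

end Orbits

/-! ### Finiteness of orbits. -/

section FiniteOrbits

variable {C : Type u} [SmallCategory C] [CategoryOfPaths C] {Q : Type w} [AddCommGroup Q]
  {ψ : DegreeFunctor C Q} {S : Set (Σ a b : C, Span a b)} {T : Set Q}

/-- Along an orbit the longest path keeps its source and degree, and the swap of longest paths alone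
already carries one point to the other. -/
theorem OrbitRel.exists_isTop (hfa : FinitelyAligned C) (ha : ψ.EqualDegreeFiniteness)
    (hT : ψ.IsClosedDegreeSet T) (hS : EqualDegrees ψ S) (hST : ∀ p ∈ S, ψ.deg p.2.2.2.1 ∈ T)
    {x y : PathSpace C} (h : OrbitRel S x y) {d : C} {e : d ⟶ x.1} (he : IsTop ψ T x.2 e) :
    ∃ f : d ⟶ y.1, IsTop ψ T y.2 f ∧ ψ.deg f = ψ.deg e ∧ Act (Zigzag.swap f e) x y := by
  induction h generalizing d with
  | rel x y h =>
    obtain ⟨p, hp, h⟩ := h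
    have hdeg := hS p hp
    obtain ⟨x, hx, rfl, rfl⟩ := h
    obtain ⟨η, rfl, h⟩ := he.map_swap hfa ha hT (hST p hp) hdeg hx
    exact ⟨_, h, by rw [ψ.deg_mul, ψ.deg_mul, hdeg],
      (Act.mk (spanZigzag p) x hx).swap_comp η he.cone_mem⟩
  | refl x => exact ⟨e, he, rfl, Act.swap_self e x.2 he.cone_mem⟩
  | symm x y _ ih =>
    obtain ⟨d', e', he'⟩ := PathCat.exists_isTop hfa ha hT x.2
    obtain ⟨f, hf, hdeg, h⟩ := ih he'
    cases hf.unique he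
    exact ⟨e', he', hdeg.symm, h.swap_symm⟩
  | trans x y z _ _ ih ih' =>
    obtain ⟨f, hf, hdeg, h⟩ := ih he
    obtain ⟨g, hg, hdeg', h'⟩ := ih' hf
    exact ⟨g, hg, hdeg'.trans hdeg, h.swap_trans h'⟩

/-- The swap of e with itself moves x to y, but it fixes x. -/
theorem OrbitRel.eq_of_isTop (hfa : FinitelyAligned C) (ha : ψ.EqualDegreeFiniteness)
    (hT : ψ.IsClosedDegreeSet T) (hS : EqualDegrees ψ S) (hST : ∀ p ∈ S, ψ.deg p.2.2.2.1 ∈ T)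
    {v d : C} {x y : Spec v} {e : d ⟶ v} (h : OrbitRel S ⟨v, x⟩ ⟨v, y⟩) (hx : IsTop ψ T x e)
    (hy : IsTop ψ T y e) : x = y := by
  obtain ⟨f, hf, -, hact⟩ := h.exists_isTop hfa ha hT hS hST hx
  obtain rfl : f = e := eq_of_heq (Sigma.mk.inj (hf.unique hy)).2
  exact eq_of_heq (Sigma.mk.inj ((Act.swap_self f x hx.cone_mem).unique hact)).2

/-- The longest path of degree in `T` at an accumulation point of an orbit has a degree different
from that along the orbit. -/
theorem OrbitRel.deg_top_ne_of_accPt (hfa : FinitelyAligned C) (hnd : ψ.Nondegenerate)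
    (ha : ψ.EqualDegreeFiniteness)
    (hT : ψ.IsClosedDegreeSet T) (hS : EqualDegrees ψ S) (hST : ∀ p ∈ S, ψ.deg p.2.2.2.1 ∈ T)
    {y z : PathSpace C} (hz : AccPt z (Filter.principal {y' | OrbitRel S y y'})) {c d : C}
    {f : c ⟶ y.1} (hf : IsTop ψ T y.2 f) {e : d ⟶ z.1} (he : IsTop ψ T z.2 e) :
    ψ.deg e ≠ ψ.deg f := by
  intro hdeg
  have heqv := OrbitRel.equivalence S
  have hN : (PathSpace.hat (cone e) : Set (PathSpace C)) ∈ 𝓝 z :=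
    PathSpace.eventually_nhds_iff.2 ⟨_, he.cone_mem, fun _ h => h⟩
  -- The longest path at an orbit point in this cone extends `e` and has the same degree, so it
  -- equals `e` by nondegeneracy.
  have htop : ∀ x : Spec z.1, OrbitRel S y ⟨z.1, x⟩ → cone e ∈ x.sets → IsTop ψ T x e := by
    intro x hx hex
    obtain ⟨f', hf', hdeg', -⟩ := hx.exists_isTop hfa ha hT hS hST hf
    obtain ⟨k, hk⟩ := hf'.exists_factor e hex he.deg_mem
    have h : (⟨c, f'⟩ : PathsTo z.1) = ⟨d, e⟩ := by
      rw [← hk]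
      exact hnd.comp_eq (hk.symm ▸ hdeg'.trans hdeg.symm)
    cases h
    exact hf'
  have hsub : ∀ y₁ ∈ (PathSpace.hat (cone e) : Set (PathSpace C)), OrbitRel S y y₁ →
      ∀ y₂ ∈ (PathSpace.hat (cone e) : Set (PathSpace C)), OrbitRel S y y₂ → y₁ = y₂ := by
    rintro _ ⟨y₁, h1, rfl⟩ h1' _ ⟨y₂, h2, rfl⟩ h2'
    rw [OrbitRel.eq_of_isTop hfa ha hT hS hST (heqv.trans (heqv.symm h1') h2')
      (htop y₁ h1' h1) (htop y₂ h2' h2)]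
  rw [accPt_iff_nhds] at hz
  obtain ⟨y₁, ⟨h1, h1'⟩, hne1⟩ := hz _ hN
  -- Removing `y₁` from the neighbourhood yields a second orbit point in the cone of `e`, which can
  -- contain only one.
  obtain ⟨y₂, ⟨⟨h2, hne⟩, h2'⟩, -⟩ := hz _ (Filter.inter_mem hN (isOpen_ne.mem_nhds hne1.symm))
  exact hne (hsub y₂ h2 h2' y₁ h1 h1')

/-- A zigzag moving y to an orbit point near z also moves points near y, in particular points of the
orbit of x, close to z. -/
theorem OrbitRel.accPt_trans (hS : EqualDegrees ψ S) {x y z : PathSpace C}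
    (hy : AccPt y (Filter.principal {y' | OrbitRel S x y'}))
    (hz : AccPt z (Filter.principal {z' | OrbitRel S y z'})) :
    AccPt z (Filter.principal {z' | OrbitRel S x z'}) := by
  rw [accPt_iff_nhds] at hy hz ⊢
  intro U hU
  obtain ⟨z₁, ⟨hz₁, h⟩, hne⟩ := hz _ (interior_mem_nhds.2 hU)
  obtain ⟨ζ, -, hζ, hR⟩ := h.exists_zigzag hS
  -- The target neighbourhood excludes z, so that the orbit point found differs from z.
  have hV : interior U ∩ {z}ᶜ ∈ 𝓝 z₁ :=
    Filter.inter_mem (isOpen_interior.mem_nhds hz₁) (isOpen_ne.mem_nhds hne)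
  obtain ⟨y', ⟨⟨z', ⟨h1, h2⟩, h3⟩, h4⟩, -⟩ := hy _ (hζ.eventually hV)
  exact ⟨z', ⟨interior_subset h1, (OrbitRel.equivalence S).trans h4 (hR _ _ h3)⟩, h2⟩

/-- The generators act only over the finitely many vertices that occur in S, and each X_v is
compact. -/
theorem OrbitRel.exists_accPt (hSf : S.Finite) {y : PathSpace C}
    (hy : {y' | OrbitRel S y y'}.Infinite) :
    ∃ z, AccPt z (Filter.principal {y' | OrbitRel S y y'}) := by
  let V : Set C := (fun p : Σ a b : C, Span a b => p.1) '' S ∪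
    (fun p : Σ a b : C, Span a b => p.2.1) '' S
  have hV : V.Finite := (hSf.image _).union (hSf.image _)
  have key : ∀ x x', OrbitRel S x x' → x = x' ∨ (x.1 ∈ V ∧ x'.1 ∈ V) := by
    intro x x' h
    induction h with
    | rel x x' h =>
      obtain ⟨p, hp, h⟩ := h
      rw [h.source_eq, h.range_eq]
      exact Or.inr ⟨Or.inr ⟨p, hp, rfl⟩, Or.inl ⟨p, hp, rfl⟩⟩
    | refl x => exact Or.inl rfl
    | symm x x' _ ih => exact ih.imp Eq.symm And.symm
    | trans x x' x'' _ _ ih ih' =>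
      rcases ih with rfl | ih
      · exact ih'
      · rcases ih' with rfl | ih'
        · exact Or.inr ih
        · exact Or.inr ⟨ih.1, ih'.2⟩
  have hK : IsCompact ({y} ∪ ⋃ v ∈ V, (PathSpace.hat (Set.univ : Set (PathsTo v)))) :=
    isCompact_singleton.union (hV.isCompact_biUnion fun v _ => PathSpace.isCompact_hat_univ v)
  obtain ⟨z, -, hz⟩ := hy.exists_accPt_of_subset_isCompact hK (by
    intro x hx
    rcases key y x hx with rfl | h
    · exact Or.inl rfl
    · obtain ⟨v, x⟩ := x
      exact Or.inr (Set.mem_biUnion h.2 (PathSpace.mk_mem_hat_iff.2 x.univ_mem)))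
  exact ⟨z, hz⟩

/-- Finitely many pairs of paths of equal degree generate an equivalence relation with finite
classes. -/
theorem OrbitRel.finite (hfa : FinitelyAligned C) (hnd : ψ.Nondegenerate)
    (ha : ψ.EqualDegreeFiniteness) (hb : ψ.ExtensionFiniteness) (hSf : S.Finite)
    (hS : EqualDegrees ψ S) (y : PathSpace C) : {y' | OrbitRel S y y'}.Finite := by
  have heqv := OrbitRel.equivalence S
  obtain ⟨T, hST, hT⟩ := hb.exists_isClosedDegreeSet y.1
    (hSf.image fun p => ψ.deg p.2.2.2.1) (by
      rintro _ ⟨p, -, rfl⟩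
      exact ⟨⟨_, _, p.2.2.2.1⟩, rfl⟩)
  replace hST : ∀ p ∈ S, ψ.deg p.2.2.2.1 ∈ T := fun p hp => hST ⟨p, hp, rfl⟩
  choose d e he using fun x : PathSpace C => PathCat.exists_isTop hfa ha hT x.2
  -- The degrees of longest paths at those accumulation points of the orbit of x whose own orbit is
  -- infinite. The cardinality of this subset of `T` drives the descent.
  let D : PathSpace C → Set Q := fun x => {t | ∃ z, {z' | OrbitRel S z z'}.Infinite ∧
    AccPt z (Filter.principal {x' | OrbitRel S x x'}) ∧ ψ.deg (e z) = t}
  have hDT : ∀ x, (D x).Finite := fun x => hT.finite.subset (by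
    rintro _ ⟨z, -, -, rfl⟩
    exact (he z).deg_mem)
  by_contra hinf
  induction hn : (D y).ncard using Nat.strong_induction_on generalizing y with
  | _ n ih =>
    obtain ⟨z, hz⟩ := OrbitRel.exists_accPt hSf hinf
    -- Were the orbit of z finite, a tower around z would make the orbits meeting its base finite,
    -- including that of y.
    have hzinf : {z' | OrbitRel S z z'}.Infinite := by
      intro hfin
      obtain ⟨t, ht⟩ := exists_tower hfa ha hb hSf hS z hfin
      obtain ⟨y', ⟨hy', hyy'⟩, -⟩ := (accPt_iff_nhds.1 hz) _ (t.isClopen_base.2.mem_nhds ht)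
      refine hinf ((Set.finite_range fun j => t.map j y').subset fun x hx => ?_)
      obtain ⟨j, rfl⟩ := t.exists_eq y' hy' x (heqv.trans (heqv.symm hyy') hx)
      exact ⟨j, rfl⟩
    refine ih _ ?_ z hzinf rfl
    rw [← hn]
    -- Inclusion is transitivity of accumulation. It is strict because the degree at z occurs in `D
    -- y` but at no accumulation point of the orbit of z.
    refine Set.ncard_lt_ncard ⟨?_, fun hsub => ?_⟩ (hDT y)
    · rintro _ ⟨z', h1, h2, rfl⟩
      exact ⟨z', h1, OrbitRel.accPt_trans hS hz h2, rfl⟩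
    · obtain ⟨z', -, h2, h3⟩ := hsub ⟨z, hzinf, hz, rfl⟩
      exact OrbitRel.deg_top_ne_of_accPt hfa hnd ha hT hS hST h2 (he z) (he z') h3

end FiniteOrbits

/-! ### Principality and topology of the kernel of the cocycle. -/

section GermTopology

variable {C : Type u} [SmallCategory C] [CategoryOfPaths C] {Q : Type w} [AddCommGroup Q]
  {ψ : DegreeFunctor C Q}

theorem ZigzagFromTo.act {x y : PathSpace C} (ζ : ZigzagFromTo x y) : Act ζ.1 x y := by
  obtain ⟨ζ, h, e⟩ := ζ
  exact ⟨x.2, h, rfl, by rw [e]; rfl⟩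

theorem Germ.mk_eq_of_eventually {x y : PathSpace C} {ζ ξ : ZigzagFromTo x y}
    (h : ∀ᶠ x' in 𝓝 x, ∃ y', Act ζ.1 x' y' ∧ Act ξ.1 x' y') : Germ.mk ζ = Germ.mk ξ := by
  obtain ⟨E, hE, hEN⟩ := PathSpace.eventually_nhds_iff.1 h
  refine Quotient.sound ⟨Spec.hat E, (Spec.mem_nhds_iff _ _).2 ⟨E, hE, subset_rfl⟩, fun p hp => ?_⟩
  obtain ⟨q, h1, h2⟩ := hEN _ (PathSpace.mk_mem_hat_iff.2 hp)
  obtain ⟨h1', rfl⟩ := h1.dom_mem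
  obtain ⟨h2', e⟩ := h2.dom_mem
  exact ⟨h1', h2', eq_of_heq (Sigma.mk.inj e).2⟩

theorem exists_zigzagFromTo {x y : PathSpace C} (g : x ⟶ y) :
    ∃ ζ : ZigzagFromTo x y, g = Germ.mk ζ :=
  (Quotient.exists_rep g).imp fun _ h => h.symm

theorem exists_act_of_hom (ψ : DegreeFunctor C Q) {x y : PathSpace C} (g : x ⟶ y) :
    ∃ ζ : Zigzag y.1 x.1, ζ.degree ψ = cocycle ψ g ∧ Act ζ x y := by
  obtain ⟨ζ, rfl⟩ := exists_zigzagFromTo g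
  exact ⟨ζ.1, rfl, ζ.act⟩

theorem exists_hom_of_act (ψ : DegreeFunctor C Q) {a b : C} {ζ : Zigzag a b} {x y : PathSpace C}
    (h : Act ζ x y) : ∃ g : x ⟶ y, cocycle ψ g = ζ.degree ψ := by
  obtain ⟨x, h, rfl, rfl⟩ := h
  exact ⟨Germ.mk ⟨ζ, h, rfl⟩, rfl⟩

/-- The kernel of the cocycle is a principal groupoid. -/
theorem hom_eq_of_cocycle_eq_zero (hfa : FinitelyAligned C) (ha : ψ.EqualDegreeFiniteness)
    (hb : ψ.ExtensionFiniteness) {x y : PathSpace C} {g h : x ⟶ y} (hg : cocycle ψ g = 0)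
    (hh : cocycle ψ h = 0) : g = h := by
  obtain ⟨ζ, rfl⟩ := exists_zigzagFromTo g
  obtain ⟨ξ, rfl⟩ := exists_zigzagFromTo h
  exact Germ.mk_eq_of_eventually (ζ.act.eventually_eq hfa ha hb hg hh ξ.act)

theorem act_of_mem_germSet (ψ : DegreeFunctor C Q) {a b : C} {ζ : Zigzag a b}
    {E : Set (PathsTo b)} {g : Quiver.Total (PathSpace C)} (hg : g ∈ germSet ζ E) :
    Act ζ g.left g.right ∧ g.left ∈ (PathSpace.hat E : Set (PathSpace C)) ∧
      ζ.degree ψ = cocycle ψ g.hom := by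
  obtain ⟨x, h, hE, rfl⟩ := hg
  exact ⟨Act.mk ζ x h, PathSpace.mk_mem_hat_iff.2 hE, rfl⟩

theorem mem_germSet (hfa : FinitelyAligned C) (ha : ψ.EqualDegreeFiniteness)
    (hb : ψ.ExtensionFiniteness) {a b : C} {ζ : Zigzag a b} (hζ : ζ.degree ψ = 0)
    {E : Set (PathsTo b)} {g : Quiver.Total (PathSpace C)} (hg : cocycle ψ g.hom = 0)
    (hact : Act ζ g.left g.right) (hE : g.left ∈ (PathSpace.hat E : Set (PathSpace C))) :
    g ∈ germSet ζ E := by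
  obtain ⟨x, y, g⟩ := g
  obtain ⟨x, h, rfl, rfl⟩ : ∃ (x' : Spec b) (h : ζ.dom ∈ x'.sets), x = ⟨b, x'⟩ ∧
    y = ⟨a, Spec.map ζ x' h⟩ := hact
  refine ⟨x, h, PathSpace.mk_mem_hat_iff.1 hE, ?_⟩
  have e : g = (germ ζ x h).hom := hom_eq_of_cocycle_eq_zero hfa ha hb hg hζ
  rw [e]
  rfl

/-- Neighbourhoods in (a space of elements of) the kernel of the cocycle. -/
theorem mem_nhds_iff_of_isInducing (hfa : FinitelyAligned C) (ha : ψ.EqualDegreeFiniteness)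
    (hb : ψ.ExtensionFiniteness) {Z : Type*} [TopologicalSpace Z]
    {f : Z → Quiver.Total (PathSpace C)} (hf : IsInducing f)
    (hc : ∀ z, cocycle ψ (f z).hom = 0) {z : Z} {a b : C} {ζ : Zigzag a b}
    (hζ : ζ.degree ψ = 0) (hact : Act ζ (f z).left (f z).right) {W : Set Z} :
    W ∈ 𝓝 z ↔ ∃ U ∈ 𝓝 (f z).left, ∀ z', (f z').left ∈ U → Act ζ (f z').left (f z').right →
      z' ∈ W := by
  constructor
  · intro hW
    rw [hf.nhds_eq_comap] at hW
    obtain ⟨V, hV, hVW⟩ := hW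
    obtain ⟨V', hV'V, hV'o, hzV'⟩ := _root_.mem_nhds_iff.1 hV
    suffices h : ∃ U ∈ 𝓝 (f z).left, ∀ z', (f z').left ∈ U →
        Act ζ (f z').left (f z').right → f z' ∈ V' by
      obtain ⟨U, hU, h⟩ := h
      exact ⟨U, hU, fun z' h1 h2 => hVW (hV'V (h z' h1 h2))⟩
    clear hV'V
    -- Only basic sets need an argument: the basic zigzag ξ through the germ has degree zero, so ζ
    -- and ξ agree near its source.
    induction hV'o with
    | basic V' h =>
      obtain ⟨c, d, ξ, E, hE, rfl⟩ := h
      obtain ⟨h1, h2, h3⟩ := act_of_mem_germSet ψ hzV'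
      rw [hc] at h3
      refine ⟨_, Filter.inter_mem ((PathSpace.isClopen_hat hE).2.mem_nhds h2)
        (hact.eventually_eq hfa ha hb hζ h3 h1), fun z' ⟨h4, y', h5, h6⟩ h7 => ?_⟩
      exact mem_germSet hfa ha hb h3 (hc z') (h5.unique h7 ▸ h6) h4
    | univ => exact ⟨Set.univ, Filter.univ_mem, fun _ _ _ => trivial⟩
    | inter s t _ _ ih ih' =>
      obtain ⟨U, hU, h⟩ := ih hzV'.1
      obtain ⟨U', hU', h'⟩ := ih' hzV'.2
      exact ⟨U ∩ U', Filter.inter_mem hU hU',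
        fun z' h1 h2 => ⟨h z' h1.1 h2, h' z' h1.2 h2⟩⟩
    | sUnion A _ ih =>
      obtain ⟨s, hs, hzs⟩ := hzV'
      obtain ⟨U, hU, h⟩ := ih s hs hzs
      exact ⟨U, hU, fun z' h1 h2 => ⟨s, hs, h z' h1 h2⟩⟩
  · rintro ⟨U, hU, h⟩
    obtain ⟨x, hx, e, -⟩ := id hact
    rw [e] at hU
    obtain ⟨E, hE, hEU⟩ := PathSpace.eventually_nhds_iff.1 hU
    rw [hf.nhds_eq_comap]
    refine ⟨germSet ζ E, IsOpen.mem_nhds ?_ ?_, fun z' hz' => ?_⟩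
    · exact TopologicalSpace.isOpen_generateFrom_of_mem ⟨a, b, ζ, E, x.mem_ring hE, rfl⟩
    · exact mem_germSet hfa ha hb hζ (hc z) hact (e ▸ PathSpace.mk_mem_hat_iff.2 hE)
    · obtain ⟨h1, h2, -⟩ := act_of_mem_germSet ψ hz'
      exact h z' (hEU _ h2) h1

end GermTopology

/-! ### From towers to elementary groupoids. -/

section Elementary

variable {C : Type u} [SmallCategory C] [CategoryOfPaths C] {Q : Type w} [AddCommGroup Q]
  {ψ : DegreeFunctor C Q}

/-- The saturation of the base of a tower. -/
def Tower.saturation {R : PathSpace C → PathSpace C → Prop} (t : Tower ψ R) :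
    Set (PathSpace C) := {x | ∃ y ∈ t.base, R y x}

theorem Tower.isClopen_saturation {R : PathSpace C → PathSpace C → Prop} (t : Tower ψ R) :
    IsClopen t.saturation := by
  choose a b ζ _ hζ using t.exists_zigzag
  have : t.saturation = ⋃ j, {x | ∃ y ∈ t.base, Act (ζ j).reverse x y} := by
    ext x
    simp only [Tower.saturation, Set.mem_iUnion, Set.mem_ofPred_eq]
    constructor
    · rintro ⟨y, hy, h⟩
      obtain ⟨j, rfl⟩ := t.exists_eq y hy x h
      exact ⟨j, y, hy, (hζ j y hy).reverse⟩
    · rintro ⟨j, y, hy, h⟩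
      refine ⟨y, hy, ?_⟩
      rw [h.of_reverse.unique (hζ j y hy)]
      exact t.rel j y hy
  rw [this]
  exact isClopen_iUnion_of_finite fun j => Act.isClopen_preimage _ t.isClopen_base

/-- The base point `y` only serves to show that the zigzags of both levels start at the same vertex,
so that one composes with the reverse of the other. -/
theorem Tower.exists_zigzag_levels {R : PathSpace C → PathSpace C → Prop} (t : Tower ψ R)
    (j k : Fin t.height) {y : PathSpace C} (hy : y ∈ t.base) :
    ∃ (a b : C) (ξ : Zigzag a b), ξ.degree ψ = 0 ∧
      ∀ y' ∈ t.base, Act ξ (t.map j y') (t.map k y') := by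
  obtain ⟨a, b, ζ, h1, h2⟩ := t.exists_zigzag j
  obtain ⟨c, d, ξ, h3, h4⟩ := t.exists_zigzag k
  obtain rfl := (h2 y hy).source_eq.symm.trans (h4 y hy).source_eq
  exact ⟨_, _, ξ.append ζ.reverse,
    by rw [Zigzag.degree_append, Zigzag.degree_reverse, h1, h3, neg_zero, add_zero],
    fun y' hy' => (h2 y' hy').reverse.append (h4 y' hy')⟩

/-- A groupoid embedded in the kernel of the cocycle is elementary if its orbit equivalence relation
is covered by a sequence of towers. -/
theorem isElementaryGroupoid_of_towers (hfa : FinitelyAligned C) (ha : ψ.EqualDegreeFiniteness)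
    (hb : ψ.ExtensionFiniteness) {Z : Type u} [Groupoid.{u} Z]
    [TopologicalSpace (Quiver.Total Z)] {f : Quiver.Total Z → Quiver.Total (PathSpace C)}
    (hf : IsInducing f) (hc : ∀ g, cocycle ψ (f g).hom = 0) (o : Z ≃ PathSpace C)
    (hl : ∀ g, (f g).left = o g.left) (hr : ∀ g, (f g).right = o g.right)
    (hsub : ∀ x y : Z, Subsingleton (x ⟶ y)) {R : PathSpace C → PathSpace C → Prop}
    (hR : Equivalence R) (hhom : ∀ x y : Z, R (o x) (o y) ↔ Nonempty (x ⟶ y))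
    (τ : ℕ → Tower ψ R) (hτ : ∀ x, ∃ i, x ∈ (τ i).saturation) : IsElementaryGroupoid Z := by
  -- Orbits already swept out by an earlier tower are discarded, so each orbit is counted once;
  -- clopen saturations keep these sets open.
  let Y : ℕ → Set (PathSpace C) := fun i => (τ i).base \ ⋃ l ∈ Set.Iio i, (τ l).saturation
  have hYo : ∀ i, IsOpen (Y i) := fun i =>
    (τ i).isClopen_base.2.sdiff
      ((Set.finite_Iio i).isClosed_biUnion fun l _ => (τ l).isClopen_saturation.1)
  have hsat : ∀ i x y, R x y → x ∈ (τ i).saturation → y ∈ (τ i).saturation :=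
    fun i x y h ⟨z, hz, hzx⟩ => ⟨z, hz, hR.trans hzx h⟩
  choose a b ζ hζ hζact using fun i => (τ i).exists_zigzag
  let u : ∀ i, Y i → Fin (τ i).height → Z := fun i y j => o.symm ((τ i).map j y.1)
  have hu : ∀ i y j, o (u i y j) = (τ i).map j y.1 := fun i y j => o.apply_symm_apply _
  have hm : ∀ i y j k, Nonempty (u i y j ⟶ u i y k) := fun i y j k => by
    rw [← hhom, hu, hu]
    exact hR.trans (hR.symm ((τ i).rel j y.1 y.2.1)) ((τ i).rel k y.1 y.2.1)
  let m : ∀ i y j k, (u i y j ⟶ u i y k) := fun i y j k => (hm i y j k).some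
  let F : (Σ i, Y i × Fin (τ i).height × Fin (τ i).height) → Quiver.Total Z :=
    fun p => ⟨_, _, m p.1 p.2.1 p.2.2.1 p.2.2.2⟩
  have hFl : ∀ p, (f (F p)).left = (τ p.1).map p.2.2.1 p.2.1.1 := fun p => by rw [hl, hu]
  have hFr : ∀ p, (f (F p)).right = (τ p.1).map p.2.2.2 p.2.1.1 := fun p => by rw [hr, hu]
  have hnhds : ∀ i (y : Y i) (j k : Fin (τ i).height) (N : Set (Σ i, Y i × Fin (τ i).height ×
      Fin (τ i).height)), N ∈ 𝓝 ⟨i, y, j, k⟩ ↔ ∃ V ∈ 𝓝 y.1, ∀ y' : Y i, y'.1 ∈ V →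
        ⟨i, y', j, k⟩ ∈ N := by
    intro i y j k N
    rw [Sigma.nhds_mk, nhds_prod_eq, nhds_prod_eq, nhds_discrete (Fin (τ i).height),
      Filter.prod_pure, Filter.map_pure, Filter.prod_pure, Filter.map_map, Filter.mem_map, nhds_subtype,
      Filter.mem_comap]
    rfl
  have htot : ∀ g g' : Quiver.Total Z, g.left = g'.left → g.right = g'.right → g = g' := by
    rintro ⟨x, y, g⟩ ⟨x', y', g'⟩ h1 h2
    obtain rfl : x = x' := h1
    obtain rfl : y = y' := h2
    rw [Subsingleton.elim g g']
  have hFinj : Function.Injective F := by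
    rintro ⟨i, y, j, k⟩ ⟨i', y', j', k'⟩ h
    have h1 : (τ i).map j y.1 = (τ i').map j' y'.1 := by
      rw [← hFl ⟨i, y, j, k⟩, ← hFl ⟨i', y', j', k'⟩, h]
    have h2 : (τ i).map k y.1 = (τ i').map k' y'.1 := by
      rw [← hFr ⟨i, y, j, k⟩, ← hFr ⟨i', y', j', k'⟩, h]
    have hrel : R y.1 y'.1 := hR.trans ((τ i).rel j _ y.2.1)
      (h1 ▸ hR.symm ((τ i').rel j' _ y'.2.1))
    -- A point of a later piece lies in no earlier saturation, so related points have the same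
    -- index.
    have hi : ∀ i i' (y : Y i) (y' : Y i'), R y.1 y'.1 → ¬ i < i' := fun i i' y y' h hlt =>
      y'.2.2 (Set.mem_biUnion (Set.mem_Iio.2 hlt) ⟨y.1, y.2.1, h⟩)
    obtain rfl : i = i' := le_antisymm (not_lt.1 (hi _ _ y' y (hR.symm hrel)))
      (not_lt.1 (hi _ _ y y' hrel))
    obtain ⟨rfl, hy⟩ := (τ i).injective _ _ _ y.2.1 _ y'.2.1 h1
    obtain ⟨rfl, -⟩ := (τ i).injective _ _ _ y.2.1 _ y'.2.1 h2
    obtain rfl := Subtype.ext hy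
    rfl
  have hFsurj : Function.Surjective F := by
    intro g
    classical
    have hx := hτ (o g.left)
    -- The first tower whose saturation contains the source is used; its base point survives the
    -- removal because saturations are invariant.
    obtain ⟨y, hy, hyx⟩ := Nat.find_spec hx
    have hymin : y ∉ ⋃ l ∈ Set.Iio (Nat.find hx), (τ l).saturation := fun hmem => by
      obtain ⟨l, hlt, h⟩ := Set.mem_iUnion₂.1 hmem
      exact Nat.find_min hx hlt (hsat l _ _ hyx h)
    obtain ⟨j, hj⟩ := (τ _).exists_eq y hy _ hyx
    obtain ⟨k, hk⟩ := (τ _).exists_eq y hy _ (hR.trans hyx ((hhom _ _).2 ⟨g.hom⟩))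
    refine ⟨⟨Nat.find hx, ⟨y, hy, hymin⟩, j, k⟩, htot _ _ ?_ ?_⟩
    · exact o.injective ((hu _ _ _).trans hj.symm)
    · exact o.injective ((hu _ _ _).trans hk.symm)
  have hFcont : Continuous F := by
    refine continuous_iff_continuousAt.2 ?_
    rintro ⟨i, y, j, k⟩ W hW
    obtain ⟨c, d, ξ, hξ, hξact⟩ := (τ i).exists_zigzag_levels j k y.2.1
    obtain ⟨U, hU, hUW⟩ := (mem_nhds_iff_of_isInducing hfa ha hb hf hc hξ
      (z := F ⟨i, y, j, k⟩) (by rw [hFl, hFr]; exact hξact y.1 y.2.1)).1 hW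
    rw [hFl] at hU
    refine (hnhds _ _ _ _ _).2 ⟨_, (hζact i j y.1 y.2.1).eventually hU, ?_⟩
    rintro y' ⟨x, hx, h⟩
    refine hUW _ ?_ (by rw [hFl, hFr]; exact hξact y'.1 y'.2.1)
    rw [hFl, (hζact i j y'.1 y'.2.1).unique h]
    exact hx
  have hFopen : IsOpenMap F := by
    refine isOpenMap_iff_nhds_le.2 ?_
    rintro ⟨i, y, j, k⟩ W hW
    obtain ⟨V, hV, hVW⟩ := (hnhds _ _ _ _ _).1 hW
    obtain ⟨c, d, ξ, hξ, hξact⟩ := (τ i).exists_zigzag_levels j k y.2.1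
    refine (mem_nhds_iff_of_isInducing hfa ha hb hf hc hξ
      (z := F ⟨i, y, j, k⟩) (by rw [hFl, hFr]; exact hξact y.1 y.2.1)).2
      -- The image of `V ∩ Y i` in level `j`; an arrow starting there and moved by ξ has the same
      -- endpoints as a value of `F`.
      ⟨{x | ∃ y' ∈ V ∩ Y i, Act (ζ i j).reverse x y'}, ?_, ?_⟩
    · rw [hFl]
      exact (hζact i j y.1 y.2.1).reverse.eventually
        (Filter.inter_mem hV ((hYo i).mem_nhds y.2))
    · rintro g ⟨y', ⟨hy', hy''⟩, h⟩ hg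
      have e1 : (f g).left = (τ i).map j y' := h.of_reverse.unique (hζact i j y' hy''.1)
      have e2 : (f g).right = (τ i).map k y' := hg.unique (e1 ▸ hξact y' hy''.1)
      have e : F ⟨i, ⟨y', hy''⟩, j, k⟩ = g := htot _ _
        (o.injective (by rw [← hl, ← hl, hFl, e1])) (o.injective (by rw [← hr, ← hr, hFr, e2]))
      exact e ▸ hVW ⟨y', hy''⟩ hy'
  exact ⟨fun i => Y i, fun i => inferInstance, fun i => (τ i).height, u, m,
    fun _ _ _ _ _ => Subsingleton.elim _ _, hFcont, hFopen, hFinj, hFsurj⟩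

end Elementary

/-! ### The unit space of G^ψ and its exhaustion by orbit subgroupoids. -/

section FixedPointGroupoid

theorem isInducing_subgroupoid {G : Type u} [Groupoid.{u} G] [TopologicalSpace (Quiver.Total G)]
    (S : Subgroupoid G) : IsInducing fun g : Quiver.Total S.objs =>
      (⟨g.left.1, g.right.1, g.hom.1⟩ : Quiver.Total G) := ⟨rfl⟩

variable {C : Type u} [SmallCategory C] [CategoryOfPaths C] {Q : Type w} [AddCommGroup Q]
  {ψ : DegreeFunctor C Q}

theorem mem_objs_fixedPointGroupoid (ψ : DegreeFunctor C Q) (x : PathSpace C) :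
    x ∈ (fixedPointGroupoid ψ).objs := by
  refine ⟨𝟙 x, ?_⟩
  show ψ.deg (𝟙 x.1) - ψ.deg (𝟙 x.1) = 0
  exact sub_self _

/-- The arrows of the kernel of the cocycle between points in the same orbit. -/
def orbitSubgroupoid (ψ : DegreeFunctor C Q) (S : Set (Σ a b : C, Span a b)) :
    Subgroupoid (fixedPointGroupoid ψ).objs where
  arrows x y := {_g | OrbitRel S x.1 y.1}
  inv h := (OrbitRel.equivalence S).symm h
  mul h _ h' := (OrbitRel.equivalence S).trans h h'

/-- The unit space of the kernel of the cocycle is the space of the category of paths. -/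
theorem nonempty_unitSpace_homeomorph (hfa : FinitelyAligned C) (ha : ψ.EqualDegreeFiniteness)
    (hb : ψ.ExtensionFiniteness) :
    Nonempty (unitSpace (fixedPointGroupoid ψ).objs ≃ₜ PathSpace C) := by
  let s : unitSpace (fixedPointGroupoid ψ).objs → PathSpace C := fun g => g.1.left.1
  have hr : ∀ g : unitSpace (fixedPointGroupoid ψ).objs, g.1.right.1 = s g := by
    rintro ⟨_, x, rfl⟩
    rfl
  have hs : IsInducing s := by
    refine isInducing_iff_nhds.2 fun g => Filter.ext fun W => ?_
    have hunit : ∀ x y z : PathSpace C, x.1 = z.1 → y = x →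
        Act (Zigzag.single (𝟙 z.1) (𝟙 z.1)) x y := by
      rintro x y z h rfl
      rw [← h]
      exact Act.unit y
    -- The trivial zigzag acts only over its own vertex, so neighbourhoods are cut down to that
    -- component of X.
    have hnhds : (PathSpace.hat (Set.univ : Set (PathsTo (s g).1)) : Set (PathSpace C)) ∈ 𝓝 (s g) :=
      (PathSpace.isClopen_hat (univ_mem_ring _)).2.mem_nhds
        (PathSpace.mk_mem_hat_iff.2 (s g).2.univ_mem)
    rw [mem_nhds_iff_of_isInducing hfa ha hb (z := g)
      ((isInducing_subgroupoid (fixedPointGroupoid ψ)).comp IsInducing.subtypeVal)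
      (fun g => g.1.hom.2) (ζ := Zigzag.single (𝟙 (s g).1) (𝟙 (s g).1)) (sub_self _)
      (hunit _ _ _ rfl (hr g)), Filter.mem_comap]
    constructor
    · rintro ⟨U, hU, h⟩
      refine ⟨U ∩ PathSpace.hat Set.univ, Filter.inter_mem hU hnhds, fun g' hg' => ?_⟩
      obtain ⟨x, -, hx⟩ := hg'.2
      have e : (s g').1 = (s g).1 := by rw [← hx]
      exact h g' hg'.1 (hunit _ _ _ e (hr g'))
    · rintro ⟨U, hU, h⟩
      exact ⟨U, hU, fun g' hg' _ => h hg'⟩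
  refine ⟨(Equiv.ofBijective s ⟨?_, ?_⟩).toHomeomorphOfIsInducing hs⟩
  · rintro ⟨_, x, rfl⟩ ⟨_, y, rfl⟩ h
    obtain rfl : x = y := Subtype.ext h
    rfl
  · exact fun x => ⟨⟨_, ⟨x, mem_objs_fixedPointGroupoid ψ x⟩, rfl⟩, rfl⟩

theorem exists_span_of_hom (hfa : FinitelyAligned C) {x y : PathSpace C} {g : x ⟶ y}
    (hg : cocycle ψ g = 0) : ∃ p : Σ a b : C, Span a b,
      ψ.deg p.2.2.2.2 = ψ.deg p.2.2.2.1 ∧ Act (spanZigzag p) x y := by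
  obtain ⟨ζ, hζ, hact⟩ := exists_act_of_hom ψ g
  rw [hg] at hζ
  obtain ⟨h, -⟩ := hact.dom_mem
  obtain ⟨c, γ, δ, hδ, hrel, heq⟩ := Spec.exists_swap hfa ζ x.2 h
  refine ⟨⟨_, _, c, γ, δ⟩, ?_, hact.congr_on hδ heq⟩
  have := Zigzag.degree_of_rel ψ ζ (hrel (𝟙 c))
  rw [hζ, Category.id_comp, Category.id_comp] at this
  exact (sub_eq_zero.1 this.symm).symm

/-- A zigzag realizing one arrow between orbit-related points relates all the points it moves, and
its germs fill a neighbourhood. -/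
theorem isOpen_orbitSubgroupoid (hfa : FinitelyAligned C) (ha : ψ.EqualDegreeFiniteness)
    (hb : ψ.ExtensionFiniteness) {S : Set (Σ a b : C, Span a b)} (hS : EqualDegrees ψ S) :
    IsOpen {g : Quiver.Total (fixedPointGroupoid ψ).objs |
      g.hom ∈ (orbitSubgroupoid ψ S).arrows g.left g.right} := by
  refine isOpen_iff_mem_nhds.2 fun g hg => ?_
  obtain ⟨ζ, hζ, hact, hR⟩ := OrbitRel.exists_zigzag hS hg
  exact (mem_nhds_iff_of_isInducing hfa ha hb (isInducing_subgroupoid (fixedPointGroupoid ψ))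
    (fun g => g.hom.2) hζ hact).2 ⟨Set.univ, Filter.univ_mem, fun g' _ h => hR _ _ h⟩

theorem isElementaryGroupoid_orbitSubgroupoid [Countable (PathSet C)] (hfa : FinitelyAligned C)
    (hnd : ψ.Nondegenerate) (ha : ψ.EqualDegreeFiniteness) (hb : ψ.ExtensionFiniteness)
    {S : Set (Σ a b : C, Span a b)} (hSf : S.Finite) (hS : EqualDegrees ψ S) :
    IsElementaryGroupoid (orbitSubgroupoid ψ S).objs := by
  have := PathSpace.secondCountable (C := C) hfa
  have heqv := OrbitRel.equivalence S
  choose t ht using fun z => exists_tower hfa ha hb hSf hS z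
    (OrbitRel.finite hfa hnd ha hb hSf hS z)
  obtain ⟨A, hA, hcov⟩ := TopologicalSpace.countable_cover_nhds
    (f := fun z => (t z).base) fun z => (t z).isClopen_base.2.mem_nhds (ht z)
  -- The empty tower guarantees a nonempty countable family, which can then be enumerated by ℕ even
  -- when X is empty.
  let t₀ : Tower ψ (OrbitRel S) :=
    { base := ∅
      isClopen_base := isClopen_empty
      height := 0
      map := fun j => j.elim0
      exists_zigzag := fun j => j.elim0
      rel := fun j => j.elim0
      exists_eq := fun _ h => h.elim
      injective := fun j => j.elim0 }
  obtain ⟨τ, hτ⟩ := ((hA.image t).insert t₀).exists_eq_range (Set.insert_nonempty _ _)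
  refine isElementaryGroupoid_of_towers hfa ha hb
    ((isInducing_subgroupoid (fixedPointGroupoid ψ)).comp
      (isInducing_subgroupoid (orbitSubgroupoid ψ S)))
    (fun g => g.hom.1.2)
    (Equiv.ofBijective (fun x : (orbitSubgroupoid ψ S).objs => x.1.1)
      ⟨fun x y h => Subtype.ext (Subtype.ext h), fun x =>
        ⟨⟨⟨x, mem_objs_fixedPointGroupoid ψ x⟩, 𝟙 _, heqv.refl x⟩, rfl⟩⟩)
    (fun _ => rfl) (fun _ => rfl)
    (fun x y => ⟨fun g h => Subtype.ext (Subtype.ext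
      (hom_eq_of_cocycle_eq_zero hfa ha hb g.1.2 h.1.2))⟩)
    heqv (fun x y => ⟨fun h => ?_, fun ⟨g⟩ => g.2⟩) τ fun x => ?_
  · obtain ⟨ζ, hζ, hact, -⟩ := OrbitRel.exists_zigzag hS h
    obtain ⟨g, hg⟩ := exists_hom_of_act ψ hact
    exact ⟨⟨⟨g, hg.trans hζ⟩, h⟩⟩
  · have hx : x ∈ ⋃ z ∈ A, (t z).base := hcov ▸ Set.mem_univ x
    obtain ⟨z, hz, hxz⟩ := Set.mem_iUnion₂.1 hx
    have hmem : t z ∈ insert t₀ (t '' A) := Or.inr ⟨z, hz, rfl⟩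
    rw [hτ] at hmem
    obtain ⟨i, hi⟩ := hmem
    exact ⟨i, x, hi ▸ hxz, heqv.refl x⟩

end FixedPointGroupoid

end PathCat

theorem theoremt {C : Type u} [SmallCategory C] [CategoryOfPaths C] [Countable (PathSet C)]
    (hfa : FinitelyAligned C) {Q : Type w} [AddCommGroup Q] (ψ : DegreeFunctor C Q)
    (hnd : ψ.Nondegenerate) (hni : ψ.NonIsotropic)
    (ha : ψ.EqualDegreeFiniteness) (hb : ψ.ExtensionFiniteness) :
    IsAFGroupoid (fixedPointGroupoid ψ).objs := by
  obtain ⟨h⟩ := nonempty_unitSpace_homeomorph hfa ha hb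
  have := PathSpace.secondCountable (C := C) hfa
  have := countable_objects (C := C)
  have := countable_hom (C := C)
  obtain ⟨f, hf⟩ := exists_injective_nat (Σ a b : C, Span a b)
  -- The equal-degree pairs with index below i in an enumeration of all spans: finite, increasing,
  -- and eventually containing each such pair.
  let S : ℕ → Set (Σ a b : C, Span a b) := fun i =>
    {p | ψ.deg p.2.2.2.2 = ψ.deg p.2.2.2.1 ∧ f p < i}
  have hS : ∀ i, EqualDegrees ψ (S i) := fun i p hp => hp.1
  have hSf : ∀ i, (S i).Finite := fun i =>
    ((Set.finite_Iio i).preimage hf.injOn).subset fun p hp => hp.2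
  refine ⟨h.symm.t2Space, h.locallyCompactSpace_iff.2 inferInstance,
    h.secondCountableTopology, h.symm.totallyDisconnectedSpace,
    fun i => orbitSubgroupoid ψ (S i), ?_, fun i => ⟨fun x => (OrbitRel.equivalence _).refl x.1⟩,
    fun i => isOpen_orbitSubgroupoid hfa ha hb (hS i), fun g => ?_,
    fun i => isElementaryGroupoid_orbitSubgroupoid hfa hnd ha hb (hSf i) (hS i)⟩
  · intro i j hij
    have hsub : S i ⊆ S j := fun p hp => ⟨hp.1, hp.2.trans_le hij⟩
    exact (Subgroupoid.le_iff _ _).2 fun hg => OrbitRel.mono hsub hg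
  · obtain ⟨p, hp, hact⟩ := exists_span_of_hom hfa g.hom.2
    exact ⟨f p + 1, Relation.EqvGen.rel _ _ ⟨p, ⟨hp, Nat.lt_succ_self _⟩, hact⟩⟩
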